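/- Let $d\ge 1$. For an integer $n\ge 0$ let $T_n$ be the Chebyshev polynomial of the first kind of degree $n$ and let $$\mathbb T_n(x)=\frac{1}{\sqrt{c_n\pi/2}}\,\frac1{\sqrt{1+x^2}}\,T_n\Big(\frac{x}{\sqrt{1+x^2}}\Big),\quad x\in\mathbb R,\qquad c_0=2,\ c_n=1\ (n\ge1),$$ be the mapped Chebyshev functions. For $N\ge 0$ let $\mathbb V_N^d\subset L^2(\mathbb R^d)$ be the $d$-fold tensor product of $\mathbb V_N=\operatorname{span}\{\mathbb T_n: 0\le n\le N\}$, that is, the span of the functions $\prod_{j=1}^d\mathbb T_{n_j}(x_j)$ with $0\le n_j\le N$, and let $\pi_N^d:L^2(\mathbb R^d)\to\mathbb V_N^d$ be the $L^2$-orthogonal projection. Functions are complex-valued (real-valued functions being a special case). For $k\in\mathbb Z_{\ge0}^d$ put $$D_x^k u=\prod_{j=1}^d\big(a(x_j)\,\partial_{x_j}\big)^{k_j}\,\breve u,\qquad \breve u(x)=u(x)\prod_{j=1}^d(1+x_j^2)^{1/2},\qquad a(t)=(1+t^2)^{3/2},$$ in the sense of distributions (equivalently $D_x^ku=\partial_y^k\breve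 u$ in the variables $y_j=x_j/\sqrt{1+x_j^2}$), and $\varpi^k(x)=\prod_{j=1}^d(1+x_j^2)^{-k_j}$. With $\mathbf 1=(1,\dots,1)$, $|k|_1=k_1+\cdots+k_d$ and $e_j$ the $j$-th unit vector, let $$B^m(\mathbb R^d)=\big\{u: D_x^ku\in L^2_{\varpi^{k+\mathbf 1}}(\mathbb R^d)\ \text{for all}\ 0\le|k|_1\le m\big\},\qquad |u|_{B^m(\mathbb R^d)}=\Big(\sum_{j=1}^d\big\|D_x^{me_j}u\big\|^2_{L^2_{\varpi^{me_j+\mathbf 1}}(\mathbb R^d)}\Big)^{1/2}.$$ (For $k=0$ the condition says $u\in L^2(\mathbb R^d)$.) For $s\ge0$ let $$\|v\|_{H^s(\mathbb R^d)}^2=\int_{\mathbb R^d}(1+|\xi|^{2s})\,|\mathscr F[v](\xi)|^2\,d\xi,\qquad \mathscr F[v](\xi)=(2\pi)^{-d/2}\int_{\mathbb R^d}v(x)e^{-i\xi\cdot x}\,dx,$$ where $\mathscr F$ is extended to $L^2(\mathbb R^d)$ and the norm is $+\infty$ if $v\notin H^s(\mathbb R^d)$. **Theorem.** Let $m\ge1$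 be an integer. There is a constant $c>0$, depending only on $d$ and $m$, such that for all $u\in B^m(\mathbb R^d)$, all integers $N\ge1$ with $N\ge m-1$, and all $s\in[0,1]$, $$\|\pi_N^du-u\|_{H^s(\mathbb R^d)}\le c\,N^{s-m}\,|u|_{B^m(\mathbb R^d)}.$$ In particular $\pi_N^d u-u\in H^s(\mathbb R^d)$. -/

import Mathlib

open MeasureTheory
open scoped FourierTransform ContDiff ENNReal

noncomputable section

namespace MappedChebyshev

/-! ### Mapped Chebyshev functions and the tensor space -/

/-- The mapped Chebyshev function
`𝕋ₙ(x) = (cₙ π / 2)^(-1/2) (1 + x²)^(-1/2) Tₙ(x / √(1 + x²))`, with `c₀ = 2` and `cₙ = 1` for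
`n ≥ 1`, where `Tₙ` is the Chebyshev polynomial of the first kind. -/
def mcf (n : ℕ) (x : ℝ) : ℝ :=
  1 / √((if n = 0 then 2 else 1) * Real.pi / 2) * (1 / √(1 + x ^ 2)) *
    (Polynomial.Chebyshev.T ℝ n).eval (x / √(1 + x ^ 2))

theorem continuous_mcf (n : ℕ) : Continuous (mcf n) := by
  have h : ∀ x : ℝ, √(1 + x ^ 2) ≠ 0 := fun x => by positivity
  unfold mcf
  fun_prop (disch := exact h _)

/-- `|x / √(1 + x²)| ≤ 1`, hence `𝕋ₙ` is dominated by a multiple of `(1 + x²)^(-1/2)`. -/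
theorem integrable_mcf_sq (n : ℕ) : Integrable (fun x : ℝ => mcf n x ^ 2) := by
  obtain ⟨C, hC⟩ := (isCompact_Icc (a := (-1 : ℝ)) (b := 1)).exists_bound_of_continuousOn
    (Polynomial.Chebyshev.T ℝ n).continuous.continuousOn
  refine (integrable_inv_one_add_sq.const_mul
    ((1 / √((if n = 0 then 2 else 1) * Real.pi / 2)) ^ 2 * C ^ 2)).mono'
    ((continuous_mcf n).pow 2).aestronglyMeasurable (Filter.Eventually.of_forall fun x => ?_)
  have hx : (0 : ℝ) < 1 + x ^ 2 := by positivity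
  have hb : |x / √(1 + x ^ 2)| ≤ 1 := by
    rw [abs_div, abs_of_pos (Real.sqrt_pos.2 hx), div_le_one (Real.sqrt_pos.2 hx)]
    exact Real.abs_le_sqrt (by linarith)
  have hT := hC _ (abs_le.1 hb)
  have hT2 : (Polynomial.Chebyshev.T ℝ n).eval (x / √(1 + x ^ 2)) ^ 2 ≤ C ^ 2 :=
    sq_le_sq' (abs_le.1 hT).1 (abs_le.1 hT).2
  rw [Real.norm_of_nonneg (sq_nonneg _), mcf, mul_pow, mul_pow]
  have h1 : (1 / √(1 + x ^ 2)) ^ 2 = (1 + x ^ 2)⁻¹ := by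
    rw [div_pow, Real.sq_sqrt hx.le, one_pow, one_div]
  rw [h1, mul_assoc, mul_assoc, mul_comm (C ^ 2)]
  gcongr

variable {d : ℕ}

/-- The tensor product mapped Chebyshev function `x ↦ ∏ⱼ 𝕋_{nⱼ}(xⱼ)` on `ℝᵈ`. -/
def tensorMcf (n : Fin d → ℕ) (x : EuclideanSpace ℝ (Fin d)) : ℂ :=
  ((∏ j, mcf (n j) (x j) : ℝ) : ℂ)

theorem memLp_tensorMcf (n : Fin d → ℕ) : MemLp (tensorMcf n) 2 volume := by
  have hcont : Continuous (tensorMcf n) := by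
    have := fun j => continuous_mcf (n j)
    unfold tensorMcf
    fun_prop
  rw [memLp_two_iff_integrable_sq_norm hcont.aestronglyMeasurable]
  have h : Integrable (fun x : Fin d → ℝ => ∏ j, mcf (n j) (x j) ^ 2) :=
    Integrable.fintype_prod (f := fun j x => mcf (n j) x ^ 2) fun j => integrable_mcf_sq (n j)
  have h2 := (PiLp.volume_preserving_ofLp (Fin d)).integrable_comp_of_integrable h
  refine h2.congr (Filter.Eventually.of_forall fun x => ?_)
  simp [tensorMcf, Finset.prod_pow, -Complex.ofReal_prod, -norm_prod, Complex.norm_real]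

/-- The space `𝕍_N^d = 𝕍_N ⊗ ⋯ ⊗ 𝕍_N` with `𝕍_N = span {𝕋ₙ : 0 ≤ n ≤ N}`, as a subspace of
`L²(ℝᵈ)`. -/
def mcfSpace (d N : ℕ) : Submodule ℂ (Lp ℂ 2 (volume : Measure (EuclideanSpace ℝ (Fin d)))) :=
  Submodule.span ℂ (Set.range fun n : Fin d → Fin (N + 1) =>
    (memLp_tensorMcf fun j => (n j : ℕ)).toLp)

instance (d N : ℕ) : FiniteDimensional ℂ (mcfSpace d N) :=
  FiniteDimensional.span_of_finite ℂ (Set.finite_range _)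

/-- The `L²(ℝᵈ)`-orthogonal projection `π_N^d` onto `𝕍_N^d`. (The space is closed under complex
conjugation, so orthogonality for the pairing `∫ u v` and for `∫ u v̄` is the same.) -/
def mcfProj (d N : ℕ) (u : Lp ℂ 2 (volume : Measure (EuclideanSpace ℝ (Fin d)))) :
    Lp ℂ 2 (volume : Measure (EuclideanSpace ℝ (Fin d))) :=
  (mcfSpace d N).starProjection u

/-! ### The mapped derivatives and the spaces `B^m` -/

/-- The function `ŭ(x) = u(x) / ∏ⱼ (1 + xⱼ²)^(-1/2)`. -/
def breve (u : EuclideanSpace ℝ (Fin d) → ℂ) (x : EuclideanSpace ℝ (Fin d)) : ℂ :=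
  ((∏ j, √(1 + x j ^ 2) : ℝ) : ℂ) * u x

/-- The formal transpose `φ ↦ -∂_{xⱼ}(a(xⱼ) φ)`, `a(t) = (1 + t²)^(3/2)`, of the operator
`a(xⱼ) ∂_{xⱼ} = ∂_{yⱼ}`, where `yⱼ = xⱼ / √(1 + xⱼ²)`. -/
def transposeDeriv (j : Fin d) (φ : EuclideanSpace ℝ (Fin d) → ℝ)
    (x : EuclideanSpace ℝ (Fin d)) : ℝ :=
  -(fderiv ℝ (fun z : EuclideanSpace ℝ (Fin d) => (1 + z j ^ 2) ^ (3 / 2 : ℝ) * φ z) x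
    (EuclideanSpace.single j 1))

/-- The formal transpose of `∏ⱼ (a(xⱼ) ∂_{xⱼ})^{kⱼ}`. -/
def transposeMultiDeriv (k : Fin d → ℕ) (φ : EuclideanSpace ℝ (Fin d) → ℝ) :
    EuclideanSpace ℝ (Fin d) → ℝ :=
  (List.finRange d).foldl (fun ψ j => (transposeDeriv j)^[k j] ψ) φ

/-- `w` is the mapped derivative `D_x^k u = ∏ⱼ (a(xⱼ) ∂_{xⱼ})^{kⱼ} ŭ = ∂_y^k ŭ`, in the sense of
distributions on `ℝᵈ`. -/
def IsMappedDeriv (k : Fin d → ℕ) (u w : EuclideanSpace ℝ (Fin d) → ℂ) : Prop :=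
  LocallyIntegrable (breve u) ∧ LocallyIntegrable w ∧
    ∀ φ : EuclideanSpace ℝ (Fin d) → ℝ, ContDiff ℝ ∞ φ → HasCompactSupport φ →
      ∫ x, φ x • w x = ∫ x, transposeMultiDeriv k φ x • breve u x

open Classical in
/-- The mapped derivative `D_x^k u` (unique up to null sets) where it exists, and `0` otherwise. -/
def mappedDeriv (k : Fin d → ℕ) (u : EuclideanSpace ℝ (Fin d) → ℂ) :
    EuclideanSpace ℝ (Fin d) → ℂ :=
  if h : ∃ w, IsMappedDeriv k u w then h.choose else 0

/-- The measure `ϖ^k(x) dx` with the weight `ϖ^k(x) = ∏ⱼ (1 + xⱼ²)^(-kⱼ)`. -/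
def weightMeasure (k : Fin d → ℕ) : Measure (EuclideanSpace ℝ (Fin d)) :=
  volume.withDensity fun x => ENNReal.ofReal (∏ j, ((1 + x j ^ 2) ^ k j)⁻¹)

/-- `u ∈ B^m(ℝᵈ)`: for all `|k|₁ ≤ m` the mapped derivative `D_x^k u` exists and lies in
`L²_{ϖ^{k+1}}(ℝᵈ)`. (For `k = 0` this says `u ∈ L²(ℝᵈ)`.) -/
def MemB (m : ℕ) (u : EuclideanSpace ℝ (Fin d) → ℂ) : Prop :=
  ∀ k : Fin d → ℕ, ∑ j, k j ≤ m →
    ∃ w, IsMappedDeriv k u w ∧ MemLp w 2 (weightMeasure (k + 1))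

/-- The semi-norm `|u|_{B^m} = (∑ⱼ ‖D_{xⱼ}^m u‖²_{L²_{ϖ^{1 + m eⱼ}}})^(1/2)`. -/
def seminormB (m : ℕ) (u : EuclideanSpace ℝ (Fin d) → ℂ) : ℝ :=
  √(∑ j : Fin d, (eLpNorm (mappedDeriv (Pi.single j m) u) 2
    (weightMeasure (Pi.single j m + 1))).toReal ^ 2)

/-! ### Fractional Sobolev norms -/

/-- The unitary Fourier transform on `L²(ℝᵈ)`, the continuous extension of
`(2π)^(-d/2) ∫ u(x) exp(-i ξ·x) dx`, expressed through the transform with kernel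
`exp(-2π i ξ·x)`. -/
def fourierUnitary (u : Lp ℂ 2 (volume : Measure (EuclideanSpace ℝ (Fin d))))
    (ξ : EuclideanSpace ℝ (Fin d)) : ℂ :=
  (((2 * Real.pi) ^ (-(d : ℝ) / 2) : ℝ) : ℂ) * (𝓕 u) ((2 * Real.pi)⁻¹ • ξ)

/-- `‖u‖_{H^s} = (∫ (1 + |ξ|^{2s}) |𝓕u(ξ)|² dξ)^(1/2)` for `u ∈ L²(ℝᵈ)`, `s ≥ 0`; it is `∞` exactly
if `u ∉ H^s(ℝᵈ)`. -/
def sobolevNorm (s : ℝ) (u : Lp ℂ 2 (volume : Measure (EuclideanSpace ℝ (Fin d)))) : ℝ≥0∞ :=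
  (∫⁻ ξ : EuclideanSpace ℝ (Fin d),
    ENNReal.ofReal ((1 + ‖ξ‖ ^ (2 * s)) * ‖fourierUnitary u ξ‖ ^ 2)) ^ (1 / 2 : ℝ)

end MappedChebyshev

end

/-!
In the variable `y = x / √(1 + x²)` the mapped Chebyshev functions become `√(1 - y²) Pₙ(y)`, with
`Pₙ` the normalised Chebyshev polynomials, and the mapped derivatives become ordinary derivatives.
The two sides of the estimate are then weighted sums over the Chebyshev coefficients `ûₙ` of `u`.

*The seminorm.* The derivatives `Pₙ^(m)` are orthogonal for the weight `(1 - y²)^(m - 1/2)`, with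
squared norms `eigen n m = ∏_{i < m} (n² - i²)` (`integral_derivative_normT_mul`). By Rodrigues'
formula the transposed derivative of order `m`, applied to the weighted `Pₙ^(m)`, returns
`eigen n m` times the weighted `Pₙ`; hence the coefficients of `D_x^{m eⱼ} u` are those of `u` times
the eigenvalue (`integral_tensorDeriv_mul_mappedDeriv`). As the derivative is distributional, the
weighted polynomial has to be cut off first. The cut-offs are functions of `ε (1 + x²)`: the class
of functions `ω^q K(y, ε (1 + x²))` is stable under the transposed derivative, with bounds uniform
in `ε`, so that dominated convergence applies. Bessel's inequality now gives
`∑ₙ (∑ⱼ eigen nⱼ m) |ûₙ|² ≤ |u|²` (`sum_sum_eigen_mul_le_seminormB_sq`).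

*The error in `L²` and `H¹`.* By the Stone–Weierstrass theorem on the cube `[-1, 1]ᵈ` the tensor
product mapped Chebyshev functions form a Hilbert basis (`mcfBasis`), so `π_N u - u` has the
coefficients `-ûₙ` outside the box `nⱼ ≤ N` and `0` inside. The partial derivative `∂ᵢ` of a basis
function is a combination, with coefficient functions bounded by `1`, of the function itself and of
a member of the orthogonal family of first mapped derivatives, whose norm is `nᵢ`. So
`‖∇v‖² ≤ 2 ∑ₙ (d + |n|²) |v̂ₙ|²`; for finite sums the left side is read off the Fourier transform, and
Fatou's lemma gives the general case (`gradEnergy_le_of_forall_sum_le`).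

*Comparison.* Outside the box some `nⱼ` exceeds `N`, and there `eigen nⱼ m ≥ (nⱼ / m)^(2m)`, because
`nⱼ ≥ N + 1 ≥ m`. This bounds both sums by the seminorm, with the factors `N^(-2m)` and `N^(2 - 2m)`.
The orders `s ∈ [0, 1]` follow from `(|ξ| / N)^(2s) ≤ 1 + (|ξ| / N)²`.
-/

noncomputable section

namespace MappedChebyshev

open Filter Topology Polynomial

variable {d : ℕ}

/-! ### The one-dimensional change of variables -/

/-- The decay factor `ω(t) = (1 + t²)^(-1/2)`; in the variable `y = t / √(1 + t²)` it is
`√(1 - y²)`. -/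
def decay (t : ℝ) : ℝ := 1 / √(1 + t ^ 2)

/-- The algebraic map `t ↦ y = t / √(1 + t²)` of `ℝ` onto `(-1, 1)`. -/
def toUnit (t : ℝ) : ℝ := t / √(1 + t ^ 2)

theorem sqrt_one_add_sq_pos (t : ℝ) : 0 < √(1 + t ^ 2) := by positivity

theorem decay_pos (t : ℝ) : 0 < decay t := by unfold decay; positivity

theorem sq_decay (t : ℝ) : decay t ^ 2 = (1 + t ^ 2)⁻¹ := by
  rw [decay, div_pow, Real.sq_sqrt (by positivity), one_pow, one_div]

theorem decay_le_one (t : ℝ) : decay t ≤ 1 := by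
  rw [decay, div_le_one (sqrt_one_add_sq_pos t)]
  exact Real.one_le_sqrt.2 (by nlinarith [sq_nonneg t])

theorem toUnit_eq (t : ℝ) : toUnit t = t * decay t := by
  rw [toUnit, decay, mul_one_div]

theorem one_sub_toUnit_sq (t : ℝ) : 1 - toUnit t ^ 2 = decay t ^ 2 := by
  rw [toUnit_eq, mul_pow, sq_decay]
  field_simp
  ring

theorem one_add_sq_mul_decay_sq (t : ℝ) : (1 + t ^ 2) * decay t ^ 2 = 1 := by
  rw [sq_decay]
  exact mul_inv_cancel₀ (by positivity)

theorem abs_toUnit_le_one (t : ℝ) : |toUnit t| ≤ 1 := by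
  rw [← sq_le_one_iff_abs_le_one]
  nlinarith [one_sub_toUnit_sq t, sq_nonneg (decay t)]

theorem toUnit_mem_Icc (t : ℝ) : toUnit t ∈ Set.Icc (-1 : ℝ) 1 := abs_le.1 (abs_toUnit_le_one t)

theorem contDiff_decay : ContDiff ℝ ∞ decay := by
  have h : ∀ t : ℝ, √(1 + t ^ 2) ≠ 0 := fun t => (sqrt_one_add_sq_pos t).ne'
  have h' : ∀ t : ℝ, 1 + t ^ 2 ≠ 0 := fun t => by positivity
  unfold decay
  exact contDiff_const.div (ContDiff.sqrt (by fun_prop) h') h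

theorem contDiff_toUnit : ContDiff ℝ ∞ toUnit := by
  have : toUnit = fun t => t * decay t := funext toUnit_eq
  rw [this]
  exact contDiff_id.mul contDiff_decay

theorem continuous_decay : Continuous decay := contDiff_decay.continuous

theorem continuous_toUnit : Continuous toUnit := contDiff_toUnit.continuous

theorem hasDerivAt_decay (t : ℝ) : HasDerivAt decay (-(toUnit t * decay t ^ 2)) t := by
  have h0 : HasDerivAt (fun t : ℝ => 1 + t ^ 2) (2 * t) t := by
    simpa using (hasDerivAt_pow 2 t).const_add 1
  have h1 := ((h0.sqrt (by positivity)).inv (sqrt_one_add_sq_pos t).ne')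
  have h2 : decay = (fun t : ℝ => √(1 + t ^ 2))⁻¹ := by
    ext s; simp [decay]
  rw [h2]
  convert! h1 using 1
  have hs := sqrt_one_add_sq_pos t
  simp only [toUnit, Pi.inv_apply]
  field_simp

theorem hasDerivAt_toUnit (t : ℝ) : HasDerivAt toUnit (decay t ^ 3) t := by
  have h := (hasDerivAt_id t).mul (hasDerivAt_decay t)
  have h2 : toUnit = id * decay := funext toUnit_eq
  rw [h2]
  convert! h using 1
  have := one_sub_toUnit_sq t
  simp only [id, one_mul]
  have e : t * -(toUnit t * decay t ^ 2) = -(toUnit t ^ 2 * decay t) := by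
    rw [toUnit_eq]; ring
  rw [e]
  linear_combination (-decay t) * this

theorem hasDerivAt_decay_pow (q : ℕ) (t : ℝ) :
    HasDerivAt (fun t => decay t ^ q) (-(q * toUnit t * decay t ^ (q + 1))) t := by
  refine ((hasDerivAt_decay t).pow q).congr_deriv ?_
  cases q with
  | zero => simp
  | succ n => simp; ring

theorem hasDerivAt_eval_toUnit (p : ℝ[X]) (t : ℝ) :
    HasDerivAt (fun t => p.eval (toUnit t)) (decay t ^ 3 * p.derivative.eval (toUnit t)) t := by
  rw [mul_comm]
  exact (p.hasDerivAt (toUnit t)).comp t (hasDerivAt_toUnit t)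

/-- A polynomial in `y = t / √(1 + t²)` is bounded on `ℝ`. -/
theorem exists_abs_eval_toUnit_le (p : ℝ[X]) : ∃ C, 0 ≤ C ∧ ∀ t, |p.eval (toUnit t)| ≤ C := by
  obtain ⟨C, hC⟩ := (isCompact_Icc (a := (-1 : ℝ)) (b := 1)).exists_bound_of_continuousOn
    p.continuous.continuousOn
  exact ⟨C, (norm_nonneg _).trans (hC 0 (by norm_num)), fun t => hC _ (toUnit_mem_Icc t)⟩

theorem tendsto_decay_cobounded : Tendsto decay (Bornology.cobounded ℝ) (𝓝 0) := by
  have h : Tendsto (fun t : ℝ => |t|⁻¹) (Bornology.cobounded ℝ) (𝓝 0) :=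
    tendsto_inv_atTop_zero.comp tendsto_norm_cobounded_atTop
  refine squeeze_zero' (Eventually.of_forall fun t => (decay_pos t).le) ?_ h
  filter_upwards [Bornology.eventually_ne_cobounded (0 : ℝ)] with t ht
  rw [decay, one_div]
  refine inv_anti₀ (abs_pos.2 ht) (Real.abs_le_sqrt (by linarith))

theorem integrable_decay_pow_mul_eval {q : ℕ} (hq : 2 ≤ q) (p : ℝ[X]) :
    Integrable fun t => decay t ^ q * p.eval (toUnit t) := by
  obtain ⟨C, hC0, hC⟩ := exists_abs_eval_toUnit_le p
  refine (integrable_inv_one_add_sq.mul_const C).mono' ?_ (Eventually.of_forall fun t => ?_)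
  · exact ((continuous_decay.pow q).mul (p.continuous.comp continuous_toUnit)).aestronglyMeasurable
  · rw [norm_mul, norm_pow, Real.norm_of_nonneg (decay_pos t).le, ← sq_decay]
    exact mul_le_mul (pow_le_pow_of_le_one (decay_pos t).le (decay_le_one t) hq) (hC t)
      (norm_nonneg _) (sq_nonneg _)

theorem image_univ_toUnit : toUnit '' Set.univ = Set.Ioo (-1) 1 := by
  ext y
  simp only [Set.image_univ, Set.mem_range, Set.mem_Ioo]
  constructor
  · rintro ⟨t, rfl⟩
    rw [← abs_lt, ← sq_lt_one_iff_abs_lt_one]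
    nlinarith [one_sub_toUnit_sq t, pow_pos (decay_pos t) 2]
  · intro h
    have h1 : 0 < 1 - y ^ 2 := by nlinarith
    refine ⟨y / √(1 - y ^ 2), ?_⟩
    have h2 : 1 + (y / √(1 - y ^ 2)) ^ 2 = (1 - y ^ 2)⁻¹ := by
      rw [div_pow, Real.sq_sqrt h1.le]; field_simp; ring
    rw [toUnit, h2, Real.sqrt_inv]
    have := Real.sqrt_pos.2 h1
    field_simp

theorem strictMono_toUnit : StrictMono toUnit :=
  strictMono_of_hasDerivAt_pos hasDerivAt_toUnit fun t => pow_pos (decay_pos t) 3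

/-- The change of variables `y = t / √(1 + t²)` turns `(1 + t²)⁻¹ dt` into the Chebyshev measure
`(1 - y²)^(-1/2) dy`. -/
theorem integral_decay_sq_mul (f : ℝ → ℝ) :
    ∫ t, decay t ^ 2 * f (toUnit t) = ∫ y, f y ∂Chebyshev.measureT := by
  rw [Chebyshev.integral_measureT, intervalIntegral.integral_of_le (by norm_num),
    integral_Ioc_eq_integral_Ioo, ← image_univ_toUnit,
    integral_image_eq_integral_abs_deriv_smul MeasurableSet.univ
      (fun t _ => (hasDerivAt_toUnit t).hasDerivWithinAt) strictMono_toUnit.injective.injOn,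
    setIntegral_univ]
  congr 1 with t
  have h := decay_pos t
  rw [one_sub_toUnit_sq, abs_of_pos (pow_pos h 3), smul_eq_mul]
  simp only [Real.sqrt_inv, Real.sqrt_sq h.le]
  field_simp

/-! ### Normalised Chebyshev polynomials and their derivatives -/

/-- The Chebyshev polynomial normalised in `L²((1 - y²)^(-1/2) dy)`, so that
`𝕋ₙ = ω · Pₙ(y)`. -/
def normT (n : ℕ) : ℝ[X] :=
  C (1 / √((if n = 0 then 2 else 1) * Real.pi / 2)) * Chebyshev.T ℝ n

theorem mcf_eq (n : ℕ) (t : ℝ) : mcf n t = decay t * (normT n).eval (toUnit t) := by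
  simp only [mcf, decay, normT, toUnit, eval_mul, eval_C]
  ring

theorem one_sub_sq_mul_eval_derivative_normT (n k : ℕ) (y : ℝ) :
    (1 - y ^ 2) * (derivative^[k + 2] (normT n)).eval y =
      (2 * k + 1) * y * (derivative^[k + 1] (normT n)).eval y -
      (n ^ 2 - k ^ 2) * (derivative^[k] (normT n)).eval y := by
  have h := Chebyshev.one_sub_X_sq_mul_iterate_derivative_T_eval (R := ℝ) n k y
  simp only [normT, iterate_derivative_C_mul, eval_mul, eval_C]
  push_cast at h
  linear_combination (1 / √((if n = 0 then 2 else 1) * Real.pi / 2)) * h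

/-- The eigenvalues `∏_{i < k} (n² - i²)`: the squared norm of the `k`-th derivative of the
normalised Chebyshev polynomial of degree `n` with respect to the weight `(1 - y²)^(k - 1/2)`. -/
def eigen (n k : ℕ) : ℝ := ∏ i ∈ Finset.range k, ((n : ℝ) ^ 2 - (i : ℝ) ^ 2)

@[simp] theorem eigen_zero (n : ℕ) : eigen n 0 = 1 := by simp [eigen]

theorem eigen_succ (n k : ℕ) : eigen n (k + 1) = eigen n k * ((n : ℝ) ^ 2 - (k : ℝ) ^ 2) := by
  simp [eigen, Finset.prod_range_succ]

@[simp] theorem eigen_one (n : ℕ) : eigen n 1 = (n : ℝ) ^ 2 := by simp [eigen]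

/-- For `i < m ≤ n` each factor satisfies `n² - i² ≥ (n / m)²`. -/
theorem pow_le_eigen {n m : ℕ} (hm : 1 ≤ m) (h : m ≤ n) :
    ((n : ℝ) / m) ^ (2 * m) ≤ eigen n m := by
  have hm0 : (0 : ℝ) < m := by exact_mod_cast hm
  have hn : (m : ℝ) ≤ n := by exact_mod_cast h
  rw [eigen, pow_mul]
  calc (((n : ℝ) / m) ^ 2) ^ m = ∏ i ∈ Finset.range m, ((n : ℝ) / m) ^ 2 := by simp
    _ ≤ _ := by
      refine Finset.prod_le_prod (fun _ _ => by positivity) fun i hi => ?_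
      have hi' : (i : ℝ) + 1 ≤ m := by exact_mod_cast Finset.mem_range.1 hi
      have hi0 : (0 : ℝ) ≤ i := by positivity
      have h1 : (i : ℝ) ^ 2 ≤ m ^ 2 - 1 := by nlinarith
      have h2 : (1 : ℝ) ≤ n ^ 2 / m ^ 2 := by
        rw [one_le_div (by positivity)]; nlinarith
      rw [div_pow]
      have h3 : (n : ℝ) ^ 2 = n ^ 2 / m ^ 2 * m ^ 2 := by field_simp
      nlinarith

theorem eigen_nonneg (n k : ℕ) : 0 ≤ eigen n k := by
  rcases le_or_gt k n with h | h
  · refine Finset.prod_nonneg fun i hi => ?_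
    have : (i : ℝ) ≤ n := by exact_mod_cast (Finset.mem_range.1 hi).le.trans h
    nlinarith [(Nat.cast_nonneg i : (0 : ℝ) ≤ i)]
  · exact (Finset.prod_eq_zero (Finset.mem_range.2 h) (sub_self _)).ge

theorem integral_normT_mul_normT (n n' : ℕ) :
    ∫ t, decay t ^ 2 * ((normT n).eval (toUnit t) * (normT n').eval (toUnit t)) =
      if n = n' then 1 else 0 := by
  rw [integral_decay_sq_mul fun y => (normT n).eval y * (normT n').eval y]
  simp only [normT, eval_mul, eval_C]
  simp_rw [mul_mul_mul_comm _ ((Chebyshev.T ℝ n).eval _)]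
  rw [integral_const_mul]
  have hpi := Real.pi_pos
  rcases eq_or_ne n n' with rfl | h
  · rcases eq_or_ne n 0 with rfl | h0
    · have := Chebyshev.integral_eval_T_real_mul_self_measureT_zero
      simp only [Nat.cast_zero, this, if_true]
      rw [← pow_two, div_pow, Real.sq_sqrt (by positivity)]
      field_simp
    · rw [Chebyshev.integral_T_real_mul_self_measureT_of_ne_zero h0]
      simp only [h0, if_true, if_false]
      rw [← pow_two, div_pow, Real.sq_sqrt (by positivity)]
      field_simp
  · rw [Chebyshev.integral_eval_T_real_mul_eval_T_real_measureT_of_ne h, if_neg h, mul_zero]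

/-- The Sturm–Liouville equation `∂_y ((1 - y²)^(k + 1/2) Pₙ^(k+1)) = -(n² - k²) (1 - y²)^(k - 1/2)
Pₙ^(k)` in the variable `t`. -/
theorem hasDerivAt_decay_pow_mul_derivative_normT (n k : ℕ) (t : ℝ) :
    HasDerivAt (fun t => decay t ^ (2 * k + 1) * (derivative^[k + 1] (normT n)).eval (toUnit t))
      (-(((n : ℝ) ^ 2 - (k : ℝ) ^ 2) *
        (decay t ^ (2 * k + 2) * (derivative^[k] (normT n)).eval (toUnit t)))) t := by
  refine ((hasDerivAt_decay_pow (2 * k + 1) t).mul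
    (hasDerivAt_eval_toUnit (derivative^[k + 1] (normT n)) t)).congr_deriv ?_
  rw [← Function.iterate_succ_apply' derivative, Nat.succ_eq_add_one, add_assoc]
  have h := one_sub_sq_mul_eval_derivative_normT n k (toUnit t)
  rw [one_sub_toUnit_sq] at h
  push_cast
  linear_combination (decay t ^ (2 * k + 2)) * h

/-- The `k`-th derivatives of the normalised Chebyshev polynomials are orthogonal for the weight
`(1 - y²)^(k - 1/2)`, by induction on `k`: integration by parts moves one derivative to the other
factor, where the Sturm–Liouville equation applies. -/
theorem integral_derivative_normT_mul (n n' k : ℕ) :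
    ∫ t, decay t ^ (2 * k + 2) * ((derivative^[k] (normT n)).eval (toUnit t) *
      (derivative^[k] (normT n')).eval (toUnit t)) = if n = n' then eigen n k else 0 := by
  induction k with
  | zero => simpa using integral_normT_mul_normT n n'
  | succ k ih =>
    set A : ℝ[X] := derivative^[k + 1] (normT n) * derivative^[k + 1] (normT n')
    set B : ℝ[X] := derivative^[k] (normT n) * derivative^[k] (normT n')
    have hA : Integrable fun t => decay t ^ (2 * k + 4) * A.eval (toUnit t) :=
      integrable_decay_pow_mul_eval (by omega) A
    have hB : Integrable fun t => decay t ^ (2 * k + 2) * B.eval (toUnit t) :=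
      integrable_decay_pow_mul_eval (by omega) B
    set F : ℝ → ℝ := fun t => decay t ^ (2 * k + 1) *
      (derivative^[k + 1] (normT n)).eval (toUnit t) * (derivative^[k] (normT n')).eval (toUnit t)
    have hF : ∀ t, HasDerivAt F (decay t ^ (2 * k + 4) * A.eval (toUnit t) -
        ((n : ℝ) ^ 2 - (k : ℝ) ^ 2) * (decay t ^ (2 * k + 2) * B.eval (toUnit t))) t := by
      intro t
      refine ((hasDerivAt_decay_pow_mul_derivative_normT n k t).mul
        (hasDerivAt_eval_toUnit (derivative^[k] (normT n')) t)).congr_deriv ?_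
      rw [← Function.iterate_succ_apply' derivative]
      simp only [A, B, eval_mul]
      ring
    -- the boundary terms vanish, because `F` is `ω` times a bounded function
    have hlim : Tendsto F (Bornology.cobounded ℝ) (𝓝 0) := by
      obtain ⟨C, hC0, hC⟩ := exists_abs_eval_toUnit_le
        (derivative^[k + 1] (normT n) * derivative^[k] (normT n'))
      have h0 : Tendsto (fun t => decay t * C) (Bornology.cobounded ℝ) (𝓝 0) := by
        simpa using tendsto_decay_cobounded.mul_const C
      refine squeeze_zero_norm (fun t => ?_) h0
      simp only [F]
      rw [mul_assoc, ← eval_mul, norm_mul, norm_pow, Real.norm_of_nonneg (decay_pos t).le]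
      exact mul_le_mul (pow_le_of_le_one (decay_pos t).le (decay_le_one t) (by omega)) (hC t)
        (norm_nonneg _) (decay_pos t).le
    rw [IsOrderBornology.cobounded_eq, tendsto_sup] at hlim
    have h := integral_of_hasDerivAt_of_tendsto hF (hA.sub (hB.const_mul _)) hlim.1 hlim.2
    rw [integral_sub hA (hB.const_mul _), integral_const_mul] at h
    simp only [A, B, eval_mul] at h
    rw [ih] at h
    rw [show 2 * (k + 1) + 2 = 2 * k + 4 by ring, eigen_succ]
    split_ifs at h ⊢ <;> linarith

/-! ### The transposed derivative in one variable and cut-off test functions -/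

/-- The one-dimensional formal transpose `g ↦ -(a g)'`, `a(t) = (1 + t²)^(3/2)`. -/
def transposeDeriv₁ (g : ℝ → ℝ) (t : ℝ) : ℝ :=
  -deriv (fun s : ℝ => (1 + s ^ 2) ^ (3 / 2 : ℝ) * g s) t

theorem rpow_mul_decay_pow (t : ℝ) (q : ℕ) :
    (1 + t ^ 2) ^ (3 / 2 : ℝ) * decay t ^ (q + 3) = decay t ^ q := by
  have h : (0 : ℝ) ≤ 1 + t ^ 2 := by positivity
  have h1 : (1 + t ^ 2) ^ (3 / 2 : ℝ) = √(1 + t ^ 2) ^ 3 := by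
    rw [Real.sqrt_eq_rpow, ← Real.rpow_natCast ((1 + t ^ 2) ^ (1 / 2 : ℝ)), ← Real.rpow_mul h]
    norm_num
  have h2 := (sqrt_one_add_sq_pos t).ne'
  rw [h1, decay, pow_add, div_pow _ _ 3]
  field_simp

theorem contDiff_one_add_sq_rpow : ContDiff ℝ ∞ fun s : ℝ => (1 + s ^ 2) ^ (3 / 2 : ℝ) :=
  ContDiff.rpow_const_of_ne (by fun_prop) fun s => by positivity

theorem contDiff_transposeDeriv₁ {g : ℝ → ℝ} (hg : ContDiff ℝ ∞ g) :
    ContDiff ℝ ∞ (transposeDeriv₁ g) :=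
  (((contDiff_infty_iff_deriv.1 (contDiff_one_add_sq_rpow.mul hg)).2)).neg

theorem transposeDeriv₁_const_mul (c : ℝ) (g : ℝ → ℝ) :
    transposeDeriv₁ (fun t => c * g t) = fun t => c * transposeDeriv₁ g t := by
  ext t
  simp only [transposeDeriv₁]
  simp_rw [mul_left_comm _ c]
  rw [deriv_const_mul_field, mul_neg]

theorem iterate_transposeDeriv₁_const_mul (m : ℕ) (c : ℝ) (g : ℝ → ℝ) :
    transposeDeriv₁^[m] (fun t => c * g t) = fun t => c * transposeDeriv₁^[m] g t := by
  induction m generalizing g with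
  | zero => rfl
  | succ m ih => rw [Function.iterate_succ_apply, transposeDeriv₁_const_mul, ih]; rfl

/-- Rodrigues' formula: `m`-fold application of the transposed derivative to the `m`-th derivative
of `Pₙ`, weighted, returns a multiple of `Pₙ`. -/
theorem iterate_transposeDeriv₁_normT (n m : ℕ) :
    transposeDeriv₁^[m] (fun t => decay t ^ (2 * m + 2) *
      (derivative^[m] (normT n)).eval (toUnit t)) =
      fun t => eigen n m * (decay t ^ 2 * (normT n).eval (toUnit t)) := by
  induction m with
  | zero => simp
  | succ m ih =>
    have h : transposeDeriv₁ (fun t => decay t ^ (2 * (m + 1) + 2) *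
        (derivative^[m + 1] (normT n)).eval (toUnit t)) = fun t => ((n : ℝ) ^ 2 - (m : ℝ) ^ 2) *
          (decay t ^ (2 * m + 2) * (derivative^[m] (normT n)).eval (toUnit t)) := by
      ext t
      simp only [transposeDeriv₁]
      simp_rw [← mul_assoc, show 2 * (m + 1) + 2 = (2 * m + 1) + 3 by ring, rpow_mul_decay_pow]
      rw [(hasDerivAt_decay_pow_mul_derivative_normT n m t).deriv]
      ring
    rw [Function.iterate_succ_apply, h, iterate_transposeDeriv₁_const_mul, ih, eigen_succ]
    ext t
    ring

/-- A profile is a smooth function `K(y, τ)` that vanishes for `τ > 2` and does not depend on `τ`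
for `τ < 1`. Composed with `y = t / √(1 + t²)` and `τ = ε (1 + t²)`, it is a function of `t` with
compact support for `ε > 0`, and for `ε → 0` it tends to `K(y, 0)` with a bound independent of
`ε`. -/
structure IsProfile (K : ℝ × ℝ → ℝ) : Prop where
  contDiff : ContDiff ℝ ∞ K
  eq_zero : ∀ y τ, 2 < τ → K (y, τ) = 0
  eq_self : ∀ y τ, τ < 1 → K (y, τ) = K (y, 0)

/-- The action of the transposed derivative on profiles weighted with `ω^(q + 3)`. -/
def profileDeriv (q : ℝ) (K : ℝ × ℝ → ℝ) (z : ℝ × ℝ) : ℝ :=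
  q * z.1 * K z - (1 - z.1 ^ 2) * fderiv ℝ K z (1, 0) - 2 * z.1 * z.2 * fderiv ℝ K z (0, 1)

theorem IsProfile.profileDeriv {K : ℝ × ℝ → ℝ} (hK : IsProfile K) (q : ℝ) :
    IsProfile (profileDeriv q K) where
  contDiff := by
    have h : ContDiff ℝ ∞ (fderiv ℝ K) := hK.contDiff.fderiv_right (by simp)
    have := hK.contDiff
    unfold MappedChebyshev.profileDeriv
    fun_prop
  eq_zero y τ hτ := by
    have h : K =ᶠ[𝓝 (y, τ)] fun _ => 0 := by
      have : ∀ᶠ z : ℝ × ℝ in 𝓝 (y, τ), 2 < z.2 :=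
        continuous_snd.continuousAt.eventually (lt_mem_nhds hτ)
      filter_upwards [this] with z hz using hK.eq_zero z.1 z.2 hz
    simp [MappedChebyshev.profileDeriv, h.fderiv_eq, hK.eq_zero y τ hτ]
  eq_self y τ hτ := by
    have h : K =ᶠ[𝓝 (y, τ)] fun z => K (z.1, 0) := by
      have : ∀ᶠ z : ℝ × ℝ in 𝓝 (y, τ), z.2 < 1 :=
        continuous_snd.continuousAt.eventually (gt_mem_nhds hτ)
      filter_upwards [this] with z hz using hK.eq_self z.1 z.2 hz
    have hd : HasFDerivAt (fun z : ℝ × ℝ => K (z.1, 0))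
        ((fderiv ℝ K (y, 0)).comp ((ContinuousLinearMap.fst ℝ ℝ ℝ).prod 0)) (y, τ) := by
      refine HasFDerivAt.comp (g := K) (y, τ) ?_ ?_
      · exact (hK.contDiff.differentiable (by simp) (y, 0)).hasFDerivAt
      · exact (ContinuousLinearMap.fst ℝ ℝ ℝ).hasFDerivAt.prodMk (hasFDerivAt_const 0 _)
    have h0 : fderiv ℝ K (y, 0) (0, 0) = 0 := map_zero (fderiv ℝ K (y, 0))
    simp [MappedChebyshev.profileDeriv, h.fderiv_eq, hd.fderiv, hK.eq_self y τ hτ, h0]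

/-- The weighted, rescaled profile `t ↦ ω(t)^q K(y, ε (1 + t²))`. -/
def profileFun (q : ℕ) (K : ℝ × ℝ → ℝ) (ε t : ℝ) : ℝ :=
  decay t ^ q * K (toUnit t, ε * (1 + t ^ 2))

theorem transposeDeriv₁_profileFun {K : ℝ × ℝ → ℝ} (hK : IsProfile K) (r : ℕ) (ε : ℝ) :
    transposeDeriv₁ (profileFun (2 * r + 4) K ε) =
      profileFun (2 * r + 2) (profileDeriv (2 * r + 1) K) ε := by
  ext t
  have h1 : HasDerivAt (fun t => (toUnit t, ε * (1 + t ^ 2))) (decay t ^ 3, ε * (2 * t)) t := by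
    refine (hasDerivAt_toUnit t).prodMk ?_
    simpa using ((hasDerivAt_pow 2 t).const_add 1).const_mul ε
  have h2 := (hK.contDiff.differentiable (by simp) _).hasFDerivAt.comp_hasDerivAt t h1
  have h3 := (hasDerivAt_decay_pow (2 * r + 1) t).mul h2
  have h4 : (fun s : ℝ => (1 + s ^ 2) ^ (3 / 2 : ℝ) * profileFun (2 * r + 4) K ε s) =
      (fun t => decay t ^ (2 * r + 1)) * (K ∘ fun t => (toUnit t, ε * (1 + t ^ 2))) := by
    ext s
    simp only [profileFun, Pi.mul_apply, Function.comp]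
    rw [← mul_assoc, show 2 * r + 4 = (2 * r + 1) + 3 by ring, rpow_mul_decay_pow]
  have h5 : ((decay t ^ 3, ε * (2 * t)) : ℝ × ℝ) =
      decay t ^ 3 • ((1, 0) : ℝ × ℝ) + (ε * (2 * t)) • ((0, 1) : ℝ × ℝ) := by simp
  rw [transposeDeriv₁, h4, h3.deriv, h5, map_add, map_smul, map_smul]
  simp only [profileFun, profileDeriv, smul_eq_mul, Function.comp]
  have h6 := one_add_sq_mul_decay_sq t
  rw [one_sub_toUnit_sq]
  set D1 := fderiv ℝ K (toUnit t, ε * (1 + t ^ 2)) (1, 0)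
  set D2 := fderiv ℝ K (toUnit t, ε * (1 + t ^ 2)) (0, 1)
  rw [toUnit_eq]
  push_cast
  linear_combination (2 * decay t ^ (2 * r + 1) * t * ε * D2) * h6

/-- Profiles are stable under the transposed derivative; the new profile does not depend on the
cut-off parameter `ε`. -/
theorem iterate_transposeDeriv₁_profileFun (m : ℕ) {K : ℝ × ℝ → ℝ} (hK : IsProfile K) :
    ∃ K', IsProfile K' ∧ ∀ ε, transposeDeriv₁^[m] (profileFun (2 * m + 2) K ε) =
      profileFun 2 K' ε := by
  induction m generalizing K with
  | zero => exact ⟨K, hK, fun ε => rfl⟩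
  | succ m ih =>
    obtain ⟨K', hK', h⟩ := ih (hK.profileDeriv (2 * m + 1))
    refine ⟨K', hK', fun ε => ?_⟩
    rw [Function.iterate_succ_apply, ← h, show 2 * (m + 1) + 2 = 2 * m + 4 by ring,
      transposeDeriv₁_profileFun hK]

theorem IsProfile.exists_bound {K : ℝ × ℝ → ℝ} (hK : IsProfile K) :
    ∃ C, 0 ≤ C ∧ ∀ q ε t, 0 ≤ ε → |profileFun q K ε t| ≤ C * decay t ^ q := by
  obtain ⟨C, hC⟩ := ((isCompact_Icc (a := (-1 : ℝ)) (b := 1)).prod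
    (isCompact_Icc (a := (0 : ℝ)) (b := 2))).exists_bound_of_continuousOn
      hK.contDiff.continuous.continuousOn
  have hC0 : 0 ≤ C := (norm_nonneg _).trans (hC (0, 0) (by simp))
  refine ⟨C, hC0, fun q ε t hε => ?_⟩
  rw [profileFun, abs_mul, abs_of_nonneg (pow_nonneg (decay_pos t).le q), mul_comm]
  refine mul_le_mul_of_nonneg_right ?_ (pow_nonneg (decay_pos t).le q)
  rcases le_or_gt (ε * (1 + t ^ 2)) 2 with h | h
  · exact hC _ ⟨toUnit_mem_Icc t, by positivity, h⟩
  · rwa [hK.eq_zero _ _ h, abs_zero]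

theorem IsProfile.eventually_eq {K : ℝ × ℝ → ℝ} (hK : IsProfile K) (q : ℕ) (t : ℝ) :
    ∀ᶠ ε in 𝓝 (0 : ℝ), profileFun q K ε t = profileFun q K 0 t := by
  have h : Tendsto (fun ε : ℝ => ε * (1 + t ^ 2)) (𝓝 0) (𝓝 (0 * (1 + t ^ 2))) :=
    tendsto_id.mul_const _
  rw [zero_mul] at h
  filter_upwards [h.eventually (gt_mem_nhds one_pos)] with ε hε
  rw [profileFun, profileFun, hK.eq_self _ _ hε, zero_mul]

theorem IsProfile.contDiff_profileFun {K : ℝ × ℝ → ℝ} (hK : IsProfile K) (q : ℕ) (ε : ℝ) :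
    ContDiff ℝ ∞ (profileFun q K ε) := by
  have h1 := contDiff_decay
  have h2 := contDiff_toUnit
  refine (h1.pow q).mul (hK.contDiff.comp (h2.prodMk ?_))
  fun_prop

theorem IsProfile.profileFun_eq_zero {K : ℝ × ℝ → ℝ} (hK : IsProfile K) (q : ℕ) {ε t : ℝ}
    (hε : 0 < ε) (ht : √(2 / ε) < |t|) : profileFun q K ε t = 0 := by
  rw [profileFun, hK.eq_zero, mul_zero]
  have h := (Real.sqrt_lt (by positivity) (abs_nonneg t)).1 ht
  rw [sq_abs, div_lt_iff₀ hε] at h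
  nlinarith

/-- The profile of a polynomial with the standard cut-off. -/
def polyProfile (p : ℝ[X]) (z : ℝ × ℝ) : ℝ := p.eval z.1 * Real.smoothTransition (2 - z.2)

theorem isProfile_polyProfile (p : ℝ[X]) : IsProfile (polyProfile p) where
  contDiff := by
    have h1 : ContDiff ℝ ∞ fun y : ℝ => p.eval y := by
      simpa using! p.contDiff_aeval ∞
    have h2 : ContDiff ℝ ∞ Real.smoothTransition := Real.smoothTransition.contDiff
    exact (h1.comp contDiff_fst).mul (h2.comp (contDiff_const.sub contDiff_snd))
  eq_zero y τ hτ := by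
    simp only [polyProfile]
    rw [Real.smoothTransition.zero_of_nonpos (by linarith), mul_zero]
  eq_self y τ hτ := by
    simp only [polyProfile]
    rw [Real.smoothTransition.one_of_one_le (by linarith),
      Real.smoothTransition.one_of_one_le (by norm_num)]

theorem profileFun_polyProfile_zero (q : ℕ) (p : ℝ[X]) (t : ℝ) :
    profileFun q (polyProfile p) 0 t = decay t ^ q * p.eval (toUnit t) := by
  simp only [profileFun, polyProfile]
  rw [Real.smoothTransition.one_of_one_le (by norm_num), mul_one]

/-! ### The transposed derivatives of tensor products -/


theorem transposeMultiDeriv_single (j : Fin d) (m : ℕ) (φ : EuclideanSpace ℝ (Fin d) → ℝ) :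
    transposeMultiDeriv (Pi.single j m) φ = (transposeDeriv j)^[m] φ := by
  have h0 : ∀ (l : List (Fin d)) (φ : EuclideanSpace ℝ (Fin d) → ℝ), j ∉ l →
      l.foldl (fun ψ i => (transposeDeriv i)^[(Pi.single j m : Fin d → ℕ) i] ψ) φ = φ := by
    intro l
    induction l with
    | nil => intros; rfl
    | cons i l ih =>
      intro φ hj
      rw [List.mem_cons, not_or] at hj
      rw [List.foldl_cons, Pi.single_eq_of_ne (Ne.symm hj.1), Function.iterate_zero, id, ih _ hj.2]
  have h1 : ∀ (l : List (Fin d)) (φ : EuclideanSpace ℝ (Fin d) → ℝ), l.Nodup → j ∈ l →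
      l.foldl (fun ψ i => (transposeDeriv i)^[(Pi.single j m : Fin d → ℕ) i] ψ) φ =
        (transposeDeriv j)^[m] φ := by
    intro l
    induction l with
    | nil => intro _ _ h; simp at h
    | cons i l ih =>
      intro φ hl hj
      rw [List.nodup_cons] at hl
      rw [List.foldl_cons]
      rcases eq_or_ne i j with rfl | hij
      · rw [h0 _ _ hl.1, Pi.single_eq_same]
      · rw [Pi.single_eq_of_ne hij, Function.iterate_zero, id]
        exact ih _ hl.2 ((List.mem_cons.1 hj).resolve_left (Ne.symm hij))
  exact h1 _ _ (List.nodup_finRange d) (List.mem_finRange j)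

/-- The transposed derivative in the direction `j` acts on a factor depending on `xⱼ` only, if the
other factor does not depend on `xⱼ`. -/
theorem transposeDeriv_mul (j : Fin d) {g : ℝ → ℝ} (hg : ContDiff ℝ ∞ g)
    {r : EuclideanSpace ℝ (Fin d) → ℝ} (hr : Differentiable ℝ r)
    (hrj : ∀ x (s : ℝ), r (x + s • EuclideanSpace.single j (1 : ℝ)) = r x) :
    transposeDeriv j (fun x => g (x j) * r x) = fun x => transposeDeriv₁ g (x j) * r x := by
  ext x
  have hA : HasFDerivAt (fun x : EuclideanSpace ℝ (Fin d) => x j)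
      (EuclideanSpace.proj j : EuclideanSpace ℝ (Fin d) →L[ℝ] ℝ) x :=
    (EuclideanSpace.proj j : EuclideanSpace ℝ (Fin d) →L[ℝ] ℝ).hasFDerivAt
  have hB := (((contDiff_one_add_sq_rpow.mul hg).differentiable (by simp) (x j)).hasDerivAt
    ).comp_hasFDerivAt x hA
  have hC := hB.mul (hr x).hasFDerivAt
  have hr0 : fderiv ℝ r x (EuclideanSpace.single j (1 : ℝ)) = 0 := by
    rw [← (hr x).lineDeriv_eq_fderiv, lineDeriv]
    simp [hrj]
  have hD : (fun z : EuclideanSpace ℝ (Fin d) => (1 + z j ^ 2) ^ (3 / 2 : ℝ) * (g (z j) * r z)) =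
      ((fun s : ℝ => (1 + s ^ 2) ^ (3 / 2 : ℝ) * g s) ∘ fun z => z j) * r := by
    ext z
    simp [mul_assoc]
  rw [transposeDeriv, hD, hC.fderiv]
  simp [hr0, transposeDeriv₁, mul_comm]

theorem iterate_transposeDeriv_mul (j : Fin d) (m : ℕ) {g : ℝ → ℝ} (hg : ContDiff ℝ ∞ g)
    {r : EuclideanSpace ℝ (Fin d) → ℝ} (hr : Differentiable ℝ r)
    (hrj : ∀ x (s : ℝ), r (x + s • EuclideanSpace.single j (1 : ℝ)) = r x) :
    (transposeDeriv j)^[m] (fun x => g (x j) * r x) =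
      fun x => transposeDeriv₁^[m] g (x j) * r x := by
  induction m generalizing g with
  | zero => rfl
  | succ m ih =>
    rw [Function.iterate_succ_apply, transposeDeriv_mul j hg hr hrj,
      ih (contDiff_transposeDeriv₁ hg)]
    rfl

/-- The transposed derivative in the direction `j` acts on the `j`-th factor of a tensor
product. -/
theorem transposeMultiDeriv_single_prod (j : Fin d) (m : ℕ) {f : Fin d → ℝ → ℝ}
    (hf : ∀ i, ContDiff ℝ ∞ (f i)) :
    transposeMultiDeriv (Pi.single j m) (fun x => ∏ i, f i (x i)) =
      fun x => ∏ i, transposeDeriv₁^[(Pi.single j m : Fin d → ℕ) i] (f i) (x i) := by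
  have h := iterate_transposeDeriv_mul j m (hf j)
    (r := fun x => ∏ i ∈ Finset.univ.erase j, f i (x i)) ?_ ?_
  · rw [transposeMultiDeriv_single]
    have h1 : (fun x : EuclideanSpace ℝ (Fin d) => ∏ i, f i (x i)) =
        fun x => f j (x j) * ∏ i ∈ Finset.univ.erase j, f i (x i) :=
      funext fun x => (Finset.mul_prod_erase Finset.univ (fun i => f i (x i))
        (Finset.mem_univ j)).symm
    rw [h1, h]
    ext x
    rw [← Finset.mul_prod_erase Finset.univ _ (Finset.mem_univ j), Pi.single_eq_same]
    congr 1
    refine Finset.prod_congr rfl fun i hi => ?_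
    rw [Pi.single_eq_of_ne (Finset.ne_of_mem_erase hi), Function.iterate_zero, id]
  · refine ContDiff.differentiable (n := ∞) ?_ (by simp)
    refine contDiff_prod fun i _ => (hf i).comp ?_
    fun_prop
  · intro x s
    refine Finset.prod_congr rfl fun i hi => ?_
    simp [Finset.ne_of_mem_erase hi]

/-! ### Orthogonal tensor products in `L²(ℝᵈ)` -/

theorem integrable_prod_coord {f : Fin d → ℝ → ℝ} (hf : ∀ i, Integrable (f i)) :
    Integrable fun x : EuclideanSpace ℝ (Fin d) => ∏ i, f i (x i) :=
  (PiLp.volume_preserving_ofLp (Fin d)).integrable_comp_of_integrable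
    (Integrable.fintype_prod hf)

theorem integral_prod_coord (f : Fin d → ℝ → ℝ) :
    ∫ x : EuclideanSpace ℝ (Fin d), ∏ i, f i (x i) = ∏ i, ∫ t, f i t := by
  rw [← integral_fintype_prod_volume_eq_prod f]
  exact (PiLp.volume_preserving_ofLp (Fin d)).integral_comp
    (MeasurableEquiv.toLp 2 (Fin d → ℝ)).symm.measurableEmbedding (fun y => ∏ i, f i (y i))

/-- The square root `∏ᵢ ω(xᵢ)^(kᵢ + 1)` of the weight `ϖ^(k + 1)`. -/
def weightRoot (k : Fin d → ℕ) (x : EuclideanSpace ℝ (Fin d)) : ℝ :=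
  ∏ i, decay (x i) ^ (k i + 1)

/-- The tensor products `∏ᵢ ω(xᵢ)^(kᵢ + 1) P_{nᵢ}^{(kᵢ)}(yᵢ)`. For `k = 0` these are the tensor
product mapped Chebyshev functions; in general they are the mapped derivatives `D_x^k` of those,
multiplied by the square root of the weight `ϖ^(k + 1)`. -/
def tensorDeriv (k n : Fin d → ℕ) (x : EuclideanSpace ℝ (Fin d)) : ℝ :=
  ∏ i, decay (x i) ^ (k i + 1) * (derivative^[k i] (normT (n i))).eval (toUnit (x i))

theorem tensorMcf_eq (n : Fin d → ℕ) (x : EuclideanSpace ℝ (Fin d)) :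
    tensorMcf n x = (tensorDeriv 0 n x : ℂ) := by
  simp [tensorMcf, tensorDeriv, mcf_eq]

theorem continuous_coord (i : Fin d) : Continuous fun x : EuclideanSpace ℝ (Fin d) => x i := by
  fun_prop

theorem continuous_weightRoot (k : Fin d → ℕ) : Continuous (weightRoot k) :=
  continuous_finsetProd _ fun i _ => (continuous_decay.comp (continuous_coord i)).pow _

theorem continuous_tensorDeriv (k n : Fin d → ℕ) : Continuous (tensorDeriv k n) :=
  continuous_finsetProd _ fun i _ => ((continuous_decay.comp (continuous_coord i)).pow _).mul
    ((Polynomial.continuous _).comp (continuous_toUnit.comp (continuous_coord i)))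

theorem weightRoot_pos (k : Fin d → ℕ) (x : EuclideanSpace ℝ (Fin d)) : 0 < weightRoot k x :=
  Finset.prod_pos fun _ _ => pow_pos (decay_pos _) _

theorem tensorDeriv_mul_tensorDeriv (k n n' : Fin d → ℕ) (x : EuclideanSpace ℝ (Fin d)) :
    tensorDeriv k n x * tensorDeriv k n' x = ∏ i, decay (x i) ^ (2 * k i + 2) *
      ((derivative^[k i] (normT (n i))).eval (toUnit (x i)) *
      (derivative^[k i] (normT (n' i))).eval (toUnit (x i))) := by
  rw [tensorDeriv, tensorDeriv, ← Finset.prod_mul_distrib]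
  exact Finset.prod_congr rfl fun i _ => by ring

theorem integral_tensorDeriv_mul (k n n' : Fin d → ℕ) :
    ∫ x, tensorDeriv k n x * tensorDeriv k n' x =
      if n = n' then ∏ i, eigen (n i) (k i) else 0 := by
  simp_rw [tensorDeriv_mul_tensorDeriv]
  rw [integral_prod_coord fun i t => decay t ^ (2 * k i + 2) *
      ((derivative^[k i] (normT (n i))).eval (toUnit t) *
      (derivative^[k i] (normT (n' i))).eval (toUnit t))]
  simp_rw [integral_derivative_normT_mul]
  split_ifs with h
  · subst h; simp
  · obtain ⟨i, hi⟩ := Function.ne_iff.1 h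
    exact Finset.prod_eq_zero (Finset.mem_univ i) (if_neg hi)

theorem memLp_weightRoot (k : Fin d → ℕ) : MemLp (weightRoot k) 2 volume := by
  rw [memLp_two_iff_integrable_sq (continuous_weightRoot k).aestronglyMeasurable]
  have h := integrable_prod_coord (d := d) (f := fun i t => decay t ^ (2 * k i + 2) * (1 : ℝ[X]).eval
    (toUnit t)) fun i => integrable_decay_pow_mul_eval (by omega) 1
  refine h.congr (Eventually.of_forall fun x => ?_)
  simp only [weightRoot, eval_one, mul_one, ← Finset.prod_pow, ← pow_mul]
  exact Finset.prod_congr rfl fun i _ => by ring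

theorem memLp_tensorDeriv (k n : Fin d → ℕ) :
    MemLp (fun x => (tensorDeriv k n x : ℂ)) 2 volume := by
  suffices h : MemLp (tensorDeriv k n) 2 volume from h.ofReal
  rw [memLp_two_iff_integrable_sq (continuous_tensorDeriv k n).aestronglyMeasurable]
  have h := integrable_prod_coord (d := d) (f := fun i t => decay t ^ (2 * k i + 2) *
    (derivative^[k i] (normT (n i)) * derivative^[k i] (normT (n i))).eval
    (toUnit t)) fun i => integrable_decay_pow_mul_eval (by omega) _
  refine h.congr (Eventually.of_forall fun x => ?_)
  simp only [eval_mul]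
  rw [pow_two, tensorDeriv_mul_tensorDeriv]

/-- `tensorDeriv` as an element of `L²(ℝᵈ)`. -/
def tensorLp (k n : Fin d → ℕ) : Lp ℂ 2 (volume : Measure (EuclideanSpace ℝ (Fin d))) :=
  (memLp_tensorDeriv k n).toLp

theorem coeFn_tensorLp (k n : Fin d → ℕ) :
    tensorLp k n =ᵐ[volume] fun x => (tensorDeriv k n x : ℂ) :=
  (memLp_tensorDeriv k n).coeFn_toLp

theorem tensorLp_zero (n : Fin d → ℕ) : tensorLp 0 n = (memLp_tensorMcf n).toLp := by
  unfold tensorLp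
  congr 1
  ext x
  exact (tensorMcf_eq n x).symm

theorem inner_tensorLp_left (k n : Fin d → ℕ)
    (f : Lp ℂ 2 (volume : Measure (EuclideanSpace ℝ (Fin d)))) :
    inner ℂ (tensorLp k n) f = ∫ x, (tensorDeriv k n x : ℂ) * f x := by
  rw [L2.inner_def]
  refine integral_congr_ae ?_
  filter_upwards [coeFn_tensorLp k n] with x hx
  rw [hx, RCLike.inner_apply, Complex.conj_ofReal, mul_comm]

theorem inner_tensorLp (k n n' : Fin d → ℕ) :
    inner ℂ (tensorLp k n) (tensorLp k n') =
      if n = n' then ((∏ i, eigen (n i) (k i) : ℝ) : ℂ) else 0 := by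
  rw [inner_tensorLp_left]
  have h : ∫ x, (tensorDeriv k n x : ℂ) * tensorLp k n' x =
      ∫ x, ((tensorDeriv k n x * tensorDeriv k n' x : ℝ) : ℂ) := by
    refine integral_congr_ae ?_
    filter_upwards [coeFn_tensorLp k n'] with x hx
    rw [hx, Complex.ofReal_mul]
  rw [h, integral_complex_ofReal, integral_tensorDeriv_mul]
  split_ifs <;> simp

theorem orthonormal_tensorLp : Orthonormal ℂ (tensorLp (0 : Fin d → ℕ)) := by
  classical
  rw [orthonormal_iff_ite]
  intro n n'
  rw [inner_tensorLp]
  simp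

/-- Pythagoras for a finite combination of pairwise orthogonal vectors. -/
theorem norm_sq_sum_of_orthogonal {H ι : Type*} [NormedAddCommGroup H] [InnerProductSpace ℂ H]
    [DecidableEq ι] {v : ι → H} {l : ι → ℝ}
    (hv : ∀ i j, inner ℂ (v i) (v j) = if i = j then (l i : ℂ) else 0) (S : Finset ι)
    (c : ι → ℂ) : ‖∑ i ∈ S, c i • v i‖ ^ 2 = ∑ i ∈ S, l i * ‖c i‖ ^ 2 := by
  have h : (inner ℂ (∑ i ∈ S, c i • v i) (∑ i ∈ S, c i • v i) : ℂ) =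
      ((∑ i ∈ S, l i * ‖c i‖ ^ 2 : ℝ) : ℂ) := by
    rw [sum_inner, Complex.ofReal_sum]
    refine Finset.sum_congr rfl fun i hi => ?_
    rw [inner_sum, Finset.sum_eq_single i]
    · rw [inner_smul_left, inner_smul_right, hv, if_pos rfl, ← mul_assoc, mul_comm _ (c i),
        Complex.mul_conj, Complex.normSq_eq_norm_sq]
      push_cast
      ring
    · intro j _ hj
      rw [inner_smul_left, inner_smul_right, hv, if_neg (Ne.symm hj), mul_zero, mul_zero]
    · exact fun h => absurd hi h
  rw [inner_self_eq_norm_sq_to_K] at h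
  exact Complex.ofReal_injective (by simpa using h)

/-- Bessel's inequality for pairwise orthogonal vectors, some of which may vanish. -/
theorem sum_le_norm_sq_of_orthogonal {H ι : Type*} [NormedAddCommGroup H] [InnerProductSpace ℂ H]
    [DecidableEq ι] {v : ι → H} {l : ι → ℝ}
    (hv : ∀ i j, inner ℂ (v i) (v j) = if i = j then (l i : ℂ) else 0) (S : Finset ι)
    (c : ι → ℂ) {w : H} (hw : ∀ i, inner ℂ (v i) w = l i * c i) :
    ∑ i ∈ S, l i * ‖c i‖ ^ 2 ≤ ‖w‖ ^ 2 := by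
  have h1 := norm_sq_sum_of_orthogonal hv S c
  have h2 : (inner ℂ (∑ i ∈ S, c i • v i) w : ℂ) = ((∑ i ∈ S, l i * ‖c i‖ ^ 2 : ℝ) : ℂ) := by
    rw [sum_inner, Complex.ofReal_sum]
    refine Finset.sum_congr rfl fun i hi => ?_
    rw [inner_smul_left, hw, mul_left_comm, mul_comm _ (c i), Complex.mul_conj,
      Complex.normSq_eq_norm_sq]
    push_cast
    ring
  have h3 := norm_inner_le_norm (𝕜 := ℂ) (∑ i ∈ S, c i • v i) w
  rw [h2, Complex.norm_real, ← h1, Real.norm_of_nonneg (sq_nonneg _)] at h3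
  rw [← h1]
  have h4 := norm_nonneg (∑ i ∈ S, c i • v i)
  nlinarith [norm_nonneg w]

/-! ### The mapped derivatives of a function and its Chebyshev coefficients -/

theorem weight_eq_sq (k : Fin d → ℕ) (x : EuclideanSpace ℝ (Fin d)) :
    ∏ j, ((1 + x j ^ 2) ^ (k + 1) j)⁻¹ = weightRoot k x ^ 2 := by
  rw [weightRoot, ← Finset.prod_pow]
  refine Finset.prod_congr rfl fun i _ => ?_
  rw [← pow_mul, mul_comm, pow_mul, sq_decay, inv_pow]
  rfl

theorem eLpNorm_weightMeasure (k : Fin d → ℕ) (w : EuclideanSpace ℝ (Fin d) → ℂ) :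
    eLpNorm w 2 (weightMeasure (k + 1)) =
      eLpNorm (fun x => (weightRoot k x : ℂ) * w x) 2 volume := by
  rw [eLpNorm_eq_lintegral_rpow_enorm_toReal (by norm_num) (by norm_num),
    eLpNorm_eq_lintegral_rpow_enorm_toReal (by norm_num) (by norm_num), weightMeasure,
    lintegral_withDensity_eq_lintegral_mul_non_measurable]
  · congr 2 with x
    have h : ‖(weightRoot k x : ℂ)‖ₑ = ENNReal.ofReal (weightRoot k x) := by
      rw [← ofReal_norm, Complex.norm_real, Real.norm_of_nonneg (weightRoot_pos k x).le]
    simp only [Pi.mul_apply, enorm_mul, weight_eq_sq, ENNReal.toReal_ofNat, ENNReal.rpow_ofNat,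
      mul_pow, h, ENNReal.ofReal_pow (weightRoot_pos k x).le]
  · simp_rw [weight_eq_sq]
    exact ((continuous_weightRoot k).pow 2).measurable.ennreal_ofReal
  · exact Eventually.of_forall fun x => ENNReal.ofReal_lt_top

theorem memLp_weightRoot_mul {k : Fin d → ℕ} {w : EuclideanSpace ℝ (Fin d) → ℂ}
    (hw : AEStronglyMeasurable w) (h : MemLp w 2 (weightMeasure (k + 1))) :
    MemLp (fun x => (weightRoot k x : ℂ) * w x) 2 volume := by
  refine ⟨?_, ?_⟩
  · exact (Complex.continuous_ofReal.comp (continuous_weightRoot k)).aestronglyMeasurable.mul hw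
  · rw [← eLpNorm_weightMeasure]
    exact h.2

theorem weightRoot_zero_mul_breve (u : EuclideanSpace ℝ (Fin d) → ℂ)
    (x : EuclideanSpace ℝ (Fin d)) : (weightRoot 0 x : ℂ) * breve u x = u x := by
  rw [breve, ← mul_assoc, ← Complex.ofReal_mul, weightRoot, ← Finset.prod_mul_distrib,
    Finset.prod_eq_one, Complex.ofReal_one, one_mul]
  intro i _
  have := (sqrt_one_add_sq_pos (x i)).ne'
  simp only [Pi.zero_apply, zero_add, pow_one, decay]
  field_simp

/-- The tensor product of profiles tested against a function that is square integrable with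
weight `ϖ^(k + 1)`, in the limit in which the cut-off is removed. -/
theorem tendsto_integral_profile (k : Fin d → ℕ) {K : Fin d → ℝ × ℝ → ℝ}
    (hK : ∀ i, IsProfile (K i)) {w : EuclideanSpace ℝ (Fin d) → ℂ} (hw : AEStronglyMeasurable w)
    (hw2 : MemLp (fun x => (weightRoot k x : ℂ) * w x) 2 volume) :
    Tendsto (fun l : ℕ => ∫ x : EuclideanSpace ℝ (Fin d),
        (∏ i, profileFun (2 * k i + 2) (K i) (1 / ((l : ℝ) + 1)) (x i)) • w x) atTop
      (𝓝 (∫ x : EuclideanSpace ℝ (Fin d), (∏ i, profileFun (2 * k i + 2) (K i) 0 (x i)) • w x)) := by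
  choose C hC0 hC using fun i => (hK i).exists_bound
  have hr : ∀ x, weightRoot k x * weightRoot k x = ∏ i, decay (x i) ^ (2 * k i + 2) := by
    intro x
    rw [weightRoot, ← Finset.prod_mul_distrib]
    exact Finset.prod_congr rfl fun i _ => by ring
  have hint : Integrable (fun x => (∏ i, C i) * ‖(weightRoot k x : ℂ) *
      ((weightRoot k x : ℂ) * w x)‖) := by
    refine Integrable.const_mul (Integrable.norm ?_) _
    have h0 : MemLp (fun x => (weightRoot k x : ℂ)) 2 volume := (memLp_weightRoot k).ofReal
    exact h0.integrable_mul hw2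
  refine tendsto_integral_of_dominated_convergence _ (fun l => ?_) hint (fun l => ?_) ?_
  · have hc : Continuous fun x : EuclideanSpace ℝ (Fin d) =>
        ∏ i, profileFun (2 * k i + 2) (K i) (1 / ((l : ℝ) + 1)) (x i) :=
      continuous_finsetProd _ fun i _ =>
        ((hK i).contDiff_profileFun _ _).continuous.comp (continuous_coord i)
    exact hc.aestronglyMeasurable.smul hw
  · refine Eventually.of_forall fun x => ?_
    rw [norm_smul, ← mul_assoc, norm_mul, ← Complex.ofReal_mul, Complex.norm_real, hr,
      Real.norm_of_nonneg (Finset.prod_nonneg fun i _ => pow_nonneg (decay_pos _).le _),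
      ← mul_assoc, ← Finset.prod_mul_distrib, norm_prod]
    refine mul_le_mul_of_nonneg_right ?_ (norm_nonneg _)
    exact Finset.prod_le_prod (fun _ _ => norm_nonneg _) fun i _ => hC i _ _ _ (by positivity)
  · refine Eventually.of_forall fun x => tendsto_const_nhds.congr' ?_
    have h : ∀ i, ∀ᶠ l : ℕ in atTop, profileFun (2 * k i + 2) (K i) (1 / ((l : ℝ) + 1)) (x i) =
        profileFun (2 * k i + 2) (K i) 0 (x i) := fun i =>
      tendsto_one_div_add_atTop_nhds_zero_nat.eventually ((hK i).eventually_eq _ (x i))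
    filter_upwards [eventually_all.2 h] with l hl
    simp_rw [hl]

theorem hasCompactSupport_prod_profile (q : Fin d → ℕ) {K : Fin d → ℝ × ℝ → ℝ}
    (hK : ∀ i, IsProfile (K i)) {ε : ℝ} (hε : 0 < ε) :
    HasCompactSupport fun x : EuclideanSpace ℝ (Fin d) =>
      ∏ i, profileFun (q i) (K i) ε (x i) := by
  have hc : IsCompact (WithLp.ofLp (p := 2) ⁻¹'
      (Set.univ.pi fun _ : Fin d => Set.Icc (-√(2 / ε)) √(2 / ε))) :=
    (PiLp.homeomorph 2 fun _ : Fin d => ℝ).isCompact_preimage.2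
      (isCompact_univ_pi fun _ => isCompact_Icc)
  refine HasCompactSupport.intro hc fun x hx => ?_
  simp only [Set.mem_preimage, Set.mem_univ_pi, not_forall] at hx
  obtain ⟨i, hi⟩ := hx
  refine Finset.prod_eq_zero (Finset.mem_univ i) ((hK i).profileFun_eq_zero _ hε ?_)
  rw [← not_le, abs_le]
  exact hi

/-- The coefficients of the mapped derivative `D_x^{m eⱼ} u` with respect to the derivatives of the
Chebyshev polynomials are the eigenvalues times the coefficients of `u`. -/
theorem integral_tensorDeriv_mul_mappedDeriv (j : Fin d) (m : ℕ) (n : Fin d → ℕ)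
    {u w : EuclideanSpace ℝ (Fin d) → ℂ} (hu : MemLp u 2 volume)
    (h : IsMappedDeriv (Pi.single j m) u w)
    (hw : MemLp w 2 (weightMeasure (Pi.single j m + 1))) :
    ∫ x, (tensorDeriv (Pi.single j m) n x : ℂ) * ((weightRoot (Pi.single j m) x : ℂ) * w x) =
      ((∏ i, eigen (n i) ((Pi.single j m : Fin d → ℕ) i) : ℝ) : ℂ) *
        ∫ x, (tensorDeriv 0 n x : ℂ) * u x := by
  set k : Fin d → ℕ := Pi.single j m with hk
  have hp : ∀ i, IsProfile (polyProfile (derivative^[k i] (normT (n i)))) := fun i =>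
    isProfile_polyProfile _
  choose K hK hKe using fun i => iterate_transposeDeriv₁_profileFun (k i) (hp i)
  -- both sides of the defining identity of `w`, tested with cut-off profiles, converge
  have h1 := tendsto_integral_profile k hp h.2.1.aestronglyMeasurable
    (memLp_weightRoot_mul h.2.1.aestronglyMeasurable hw)
  have h2 := tendsto_integral_profile 0 hK h.1.aestronglyMeasurable
    (by simpa only [weightRoot_zero_mul_breve] using hu)
  have h3 : ∀ l : ℕ, ∫ x : EuclideanSpace ℝ (Fin d), (∏ i, profileFun (2 * k i + 2)
        (polyProfile (derivative^[k i] (normT (n i)))) (1 / ((l : ℝ) + 1)) (x i)) • w x =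
      ∫ x : EuclideanSpace ℝ (Fin d), (∏ i, profileFun (2 * (0 : Fin d → ℕ) i + 2) (K i)
        (1 / ((l : ℝ) + 1)) (x i)) • breve u x := by
    intro l
    rw [h.2.2 _ ?_ (hasCompactSupport_prod_profile _ hp (by positivity))]
    · rw [hk, transposeMultiDeriv_single_prod j m fun i => (hp i).contDiff_profileFun _ _, ← hk]
      simp_rw [hKe]
      rfl
    · exact contDiff_prod fun i _ => ((hp i).contDiff_profileFun _ _).comp (by fun_prop)
  simp_rw [h3] at h1
  have h4 := tendsto_nhds_unique h1 h2
  -- without cut-off, the transposed derivatives are given by Rodrigues' formula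
  have h5 : ∀ i t, profileFun (2 * (0 : Fin d → ℕ) i + 2) (K i) 0 t =
      eigen (n i) (k i) * (decay t ^ 2 * (normT (n i)).eval (toUnit t)) := by
    intro i t
    have h6 := congrFun (hKe i 0) t
    have h7 : profileFun (2 * k i + 2) (polyProfile (derivative^[k i] (normT (n i)))) 0 =
        fun t => decay t ^ (2 * k i + 2) * (derivative^[k i] (normT (n i))).eval (toUnit t) :=
      funext fun t => profileFun_polyProfile_zero _ _ t
    rw [h7, iterate_transposeDeriv₁_normT] at h6
    exact h6.symm
  rw [← integral_const_mul]
  refine (integral_congr_ae (Eventually.of_forall fun x => ?_)).trans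
    (h4.trans (integral_congr_ae (Eventually.of_forall fun x => ?_)).symm)
  · rw [Complex.real_smul, ← mul_assoc, ← Complex.ofReal_mul, tensorDeriv, weightRoot,
      ← Finset.prod_mul_distrib]
    congr 2
    refine Finset.prod_congr rfl fun i _ => ?_
    rw [profileFun_polyProfile_zero]
    ring
  · dsimp only
    rw [Complex.real_smul, ← weightRoot_zero_mul_breve u, ← mul_assoc, ← mul_assoc,
      ← Complex.ofReal_mul, ← Complex.ofReal_mul, tensorDeriv, weightRoot,
      ← Finset.prod_mul_distrib, ← Finset.prod_mul_distrib]
    congr 2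
    refine Finset.prod_congr rfl fun i _ => ?_
    rw [h5]
    simp only [Pi.zero_apply, Function.iterate_zero, id]
    ring

theorem prod_eigen_single (n : Fin d → ℕ) (j : Fin d) (m : ℕ) :
    ∏ i, eigen (n i) ((Pi.single j m : Fin d → ℕ) i) = eigen (n j) m := by
  rw [Finset.prod_eq_single j]
  · rw [Pi.single_eq_same]
  · intro i _ hi
    rw [Pi.single_eq_of_ne hi, eigen_zero]
  · simp

/-- Mapped derivatives are unique up to null sets. -/
theorem IsMappedDeriv.ae_eq {k : Fin d → ℕ} {u w w' : EuclideanSpace ℝ (Fin d) → ℂ}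
    (h : IsMappedDeriv k u w) (h' : IsMappedDeriv k u w') : w =ᵐ[volume] w' :=
  ae_eq_of_integral_contDiff_smul_eq h.2.1 h'.2.1 fun φ hφ hφc => by
    rw [h.2.2 φ hφ hφc, h'.2.2 φ hφ hφc]

theorem sum_eigen_mul_le (j : Fin d) (m : ℕ)
    (u : Lp ℂ 2 (volume : Measure (EuclideanSpace ℝ (Fin d)))) (hu : MemB m u)
    (S : Finset (Fin d → ℕ)) :
    ∑ n ∈ S, eigen (n j) m * ‖inner ℂ (tensorLp 0 n) u‖ ^ 2 ≤
      (eLpNorm (mappedDeriv (Pi.single j m) u) 2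
        (weightMeasure (Pi.single j m + 1))).toReal ^ 2 := by
  obtain ⟨w₀, hw₀, hw₀2⟩ := hu (Pi.single j m) (by simp)
  have hex : ∃ w, IsMappedDeriv (Pi.single j m) u w := ⟨w₀, hw₀⟩
  have hw : IsMappedDeriv (Pi.single j m) u (mappedDeriv (Pi.single j m) u) := by
    rw [mappedDeriv, dif_pos hex]
    exact hex.choose_spec
  set w := mappedDeriv (Pi.single j m) u
  have hw2 : MemLp w 2 (weightMeasure (Pi.single j m + 1)) := by
    refine (memLp_congr_ae ?_).1 hw₀2
    exact (withDensity_absolutelyContinuous _ _).ae_eq (hw₀.ae_eq hw)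
  have hW := memLp_weightRoot_mul hw.2.1.aestronglyMeasurable hw2
  have h := sum_le_norm_sq_of_orthogonal (inner_tensorLp (Pi.single j m)) S
    (fun n => inner ℂ (tensorLp 0 n) u) (w := hW.toLp) ?_
  · simp_rw [prod_eigen_single] at h
    rwa [Lp.norm_toLp, ← eLpNorm_weightMeasure] at h
  · intro n
    rw [inner_tensorLp_left, inner_tensorLp_left,
      ← integral_tensorDeriv_mul_mappedDeriv j m n (Lp.memLp u) hw hw2]
    refine integral_congr_ae ?_
    filter_upwards [hW.coeFn_toLp] with x hx
    rw [hx]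

theorem seminormB_nonneg (m : ℕ) (u : EuclideanSpace ℝ (Fin d) → ℂ) : 0 ≤ seminormB m u :=
  Real.sqrt_nonneg _

/-- Bessel's inequality for the mapped derivatives of order `m`. -/
theorem sum_sum_eigen_mul_le_seminormB_sq (m : ℕ)
    (u : Lp ℂ 2 (volume : Measure (EuclideanSpace ℝ (Fin d)))) (hu : MemB m u)
    (S : Finset (Fin d → ℕ)) :
    ∑ n ∈ S, (∑ j, eigen (n j) m) * ‖inner ℂ (tensorLp 0 n) u‖ ^ 2 ≤ seminormB m u ^ 2 := by
  simp_rw [Finset.sum_mul]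
  rw [Finset.sum_comm, seminormB, Real.sq_sqrt (Finset.sum_nonneg fun _ _ => sq_nonneg _)]
  exact Finset.sum_le_sum fun j _ => sum_eigen_mul_le j m u hu S

/-! ### Completeness of the mapped Chebyshev functions -/

/-- The map `x ↦ y`, `yⱼ = xⱼ / √(1 + xⱼ²)`, as a map into the compact cube `[-1, 1]ᵈ`. -/
def toCube (x : EuclideanSpace ℝ (Fin d)) : Fin d → Set.Icc (-1 : ℝ) 1 :=
  fun i => ⟨toUnit (x i), toUnit_mem_Icc (x i)⟩

theorem continuous_toCube : Continuous (toCube (d := d)) :=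
  continuous_pi fun i => (continuous_toUnit.comp (continuous_coord i)).subtype_mk _

theorem isOpenEmbedding_toUnit : IsOpenEmbedding toUnit := by
  have hr : Set.range toUnit = Set.Ioo (-1) 1 := by rw [← Set.image_univ, image_univ_toUnit]
  have ho : Set.OrdConnected (Set.range toUnit) := by rw [hr]; exact Set.ordConnected_Ioo
  exact ⟨strictMono_toUnit.isEmbedding_of_ordConnected ho, by rw [hr]; exact isOpen_Ioo⟩

/-- A continuous function of compact support on `ℝᵈ` extends continuously to the cube. -/
theorem exists_continuousMap_comp_toCube {φ : EuclideanSpace ℝ (Fin d) → ℝ} (hφ : Continuous φ)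
    (hφc : HasCompactSupport φ) :
    ∃ g : C(Fin d → Set.Icc (-1 : ℝ) 1, ℝ), ∀ x, g (toCube x) = φ x := by
  set Y : EuclideanSpace ℝ (Fin d) → Fin d → ℝ := fun x i => toUnit (x i)
  have hYo : IsOpenEmbedding Y := by
    have h : IsOpenEmbedding (Pi.map fun _ : Fin d => toUnit) :=
      IsOpenEmbedding.piMap fun _ => isOpenEmbedding_toUnit
    exact h.comp (PiLp.homeomorph 2 fun _ : Fin d => ℝ).isOpenEmbedding
  have hext : ∀ x, Y.extend φ 0 (Y x) = φ x := fun x => hYo.injective.extend_apply _ _ _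
  have hcont : Continuous (Y.extend φ 0) := by
    refine continuous_of_tsupport fun y hy => ?_
    obtain ⟨x, _, rfl⟩ := hφc.tsupport_extend_zero_subset hYo.continuous hy
    rw [← hYo.continuousAt_iff, Function.extend_comp hYo.injective]
    exact hφ.continuousAt
  refine ⟨⟨fun z => Y.extend φ 0 fun i => (z i : ℝ), hcont.comp ?_⟩, fun x => hext x⟩
  fun_prop

/-- The normalisation may be dropped and, since `T₋ₙ = Tₙ`, negative indices be allowed. -/
theorem integral_chebyshev_mul_eq_zero {v : EuclideanSpace ℝ (Fin d) → ℂ}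
    (h : ∀ n : Fin d → ℕ, ∫ x, (∏ i, (normT (n i)).eval (toUnit (x i))) • v x = 0)
    (n : Fin d → ℤ) : ∫ x, (∏ i, (Chebyshev.T ℝ (n i)).eval (toUnit (x i))) • v x = 0 := by
  have h0 := h fun i => (n i).natAbs
  have hp := Real.pi_pos
  set γ : Fin d → ℝ := fun i => 1 / √((if (n i).natAbs = 0 then 2 else 1) * Real.pi / 2)
  have hγ : ∏ i, γ i ≠ 0 := by
    refine Finset.prod_ne_zero_iff.2 fun i _ => ?_
    have : 0 < (if (n i).natAbs = 0 then (2 : ℝ) else 1) := by split_ifs <;> norm_num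
    positivity
  simp only [normT, eval_mul, eval_C, Finset.prod_mul_distrib, mul_smul, Chebyshev.T_natAbs] at h0
  rw [integral_smul] at h0
  exact (smul_eq_zero.1 h0).resolve_left hγ

/-- A function annihilated by all tensor products of Chebyshev polynomials in `y` is annihilated
by all continuous functions on the cube, by the Stone–Weierstrass theorem. -/
theorem integral_comp_toCube_eq_zero {v : EuclideanSpace ℝ (Fin d) → ℂ} (hv : Integrable v)
    (h : ∀ n : Fin d → ℤ, ∫ x, (∏ i, (Chebyshev.T ℝ (n i)).eval (toUnit (x i))) • v x = 0)
    (g : C(Fin d → Set.Icc (-1 : ℝ) 1, ℝ)) : ∫ x, g (toCube x) • v x = 0 := by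
  have hbdd : ∀ g : C(Fin d → Set.Icc (-1 : ℝ) 1, ℝ),
      Integrable fun x => g (toCube x) • v x := fun g =>
    hv.bdd_smul ‖g‖ (g.continuous.comp continuous_toCube).aestronglyMeasurable
      (Eventually.of_forall fun x => g.norm_coe_le_norm _)
  -- `Tn n` is the tensor product of Chebyshev polynomials as a function on the cube
  let Tn : (Fin d → ℤ) → C(Fin d → Set.Icc (-1 : ℝ) 1, ℝ) := fun n =>
    ⟨fun z => ∏ i, (Chebyshev.T ℝ (n i)).eval (z i : ℝ),
      continuous_finsetProd _ fun i _ => (Polynomial.continuous _).comp (by fun_prop)⟩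
  let c : Fin d → C(Fin d → Set.Icc (-1 : ℝ) 1, ℝ) := fun i => ⟨fun z => (z i : ℝ), by fun_prop⟩
  let P : C(Fin d → Set.Icc (-1 : ℝ) 1, ℝ) → Prop := fun f =>
    ∀ n, ∫ x, (f * Tn n) (toCube x) • v x = 0
  have hP1 : P 1 := fun n => by rw [one_mul]; exact h n
  have hadd : ∀ f g : C(Fin d → Set.Icc (-1 : ℝ) 1, ℝ), ∫ x, (f + g) (toCube x) • v x =
      (∫ x, f (toCube x) • v x) + ∫ x, g (toCube x) • v x := fun f g => by
    rw [← integral_add (hbdd f) (hbdd g)]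
    simp only [ContinuousMap.add_apply, add_smul]
  have hsmul : ∀ (r : ℝ) (f : C(Fin d → Set.Icc (-1 : ℝ) 1, ℝ)),
      ∫ x, (r • f) (toCube x) • v x = r • ∫ x, f (toCube x) • v x := fun r f => by
    rw [← integral_smul]
    simp only [ContinuousMap.smul_apply, smul_assoc]
  -- multiplication by a coordinate shifts the degree in that coordinate
  have hcT : ∀ i n, c i * Tn n = (1 / 2 : ℝ) • (Tn (Function.update n i (n i + 1)) +
      Tn (Function.update n i (n i - 1))) := by
    intro i n
    ext z
    have h1 : ∀ k, ∏ l, (Chebyshev.T ℝ (Function.update n i k l)).eval (z l : ℝ) =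
        (Chebyshev.T ℝ k).eval (z i : ℝ) *
          ∏ l ∈ Finset.univ.erase i, (Chebyshev.T ℝ (n l)).eval (z l : ℝ) := by
      intro k
      rw [← Finset.mul_prod_erase Finset.univ _ (Finset.mem_univ i), Function.update_self]
      congr 1
      refine Finset.prod_congr rfl fun l hl => ?_
      rw [Function.update_of_ne (Finset.ne_of_mem_erase hl)]
    have h2 := h1 (n i)
    rw [Function.update_eq_self] at h2
    simp only [ContinuousMap.mul_apply, ContinuousMap.smul_apply, ContinuousMap.add_apply,
      ContinuousMap.coe_mk, c, Tn, h1, h2, smul_eq_mul]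
    rw [Chebyshev.T_add_one]
    simp only [eval_sub, eval_mul, eval_ofNat, eval_X]
    ring
  -- so `P` is stable under multiplication by polynomials in the coordinates
  have key : ∀ g ∈ Algebra.adjoin ℝ (Set.range c), ∀ f, P f → P (g * f) := by
    intro g hg
    refine Algebra.adjoin_induction (p := fun g _ => ∀ f, P f → P (g * f)) ?_ ?_ ?_ ?_ hg
    · rintro _ ⟨i, rfl⟩ f hf n
      rw [mul_comm (c i), mul_assoc, hcT, mul_smul_comm, mul_add, hsmul, hadd, hf, hf, add_zero,
        smul_zero]
    · intro r f hf n
      rw [mul_assoc, ← Algebra.smul_def, hsmul, hf, smul_zero]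
    · intro g₁ g₂ _ _ h₁ h₂ f hf n
      rw [add_mul, add_mul, hadd, h₁ f hf, h₂ f hf, add_zero]
    · intro g₁ g₂ _ _ h₁ h₂ f hf
      rw [mul_assoc]
      exact h₁ _ (h₂ f hf)
  have hT0 : Tn 0 = 1 := by ext z; simp [Tn]
  have key2 : ∀ g ∈ Algebra.adjoin ℝ (Set.range c), ∫ x, g (toCube x) • v x = 0 := by
    intro g hg
    simpa [hT0] using key g hg 1 hP1 0
  have hsep : (Algebra.adjoin ℝ (Set.range c)).SeparatesPoints := by
    intro z z' hz
    obtain ⟨i, hi⟩ := Function.ne_iff.1 hz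
    exact ⟨c i, ⟨c i, Algebra.subset_adjoin ⟨i, rfl⟩, rfl⟩, fun h => hi (Subtype.ext h)⟩
  have hcl : g ∈ (Algebra.adjoin ℝ (Set.range c)).topologicalClosure := by
    rw [ContinuousMap.subalgebra_topologicalClosure_eq_top_of_separatesPoints _ hsep]
    trivial
  have hcl' : g ∈ closure ((Algebra.adjoin ℝ (Set.range c) : Subalgebra ℝ _) : Set _) := hcl
  have hcont : Continuous fun g : C(Fin d → Set.Icc (-1 : ℝ) 1, ℝ) =>
      ∫ x, g (toCube x) • v x := by
    let L : C(Fin d → Set.Icc (-1 : ℝ) 1, ℝ) →ₗ[ℝ] ℂ :=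
      { toFun := fun g => ∫ x, g (toCube x) • v x, map_add' := hadd, map_smul' := hsmul }
    refine (L.mkContinuous (∫ x, ‖v x‖) fun g => ?_).continuous
    change ‖∫ x, g (toCube x) • v x‖ ≤ _
    rw [mul_comm, ← integral_const_mul]
    refine norm_integral_le_of_norm_le (hv.norm.const_mul _) (Eventually.of_forall fun x => ?_)
    rw [norm_smul]
    exact mul_le_mul_of_nonneg_right (g.norm_coe_le_norm _) (norm_nonneg _)
  have hclosed : IsClosed {g : C(Fin d → Set.Icc (-1 : ℝ) 1, ℝ) |
      ∫ x, g (toCube x) • v x = 0} := isClosed_eq hcont continuous_const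
  exact closure_minimal key2 hclosed hcl'

/-- Completeness: `u` times the square root of the weight is integrable and annihilated by all
continuous functions on the cube, hence by all test functions on `ℝᵈ`. -/
theorem eq_zero_of_forall_inner_tensorLp_eq_zero
    (u : Lp ℂ 2 (volume : Measure (EuclideanSpace ℝ (Fin d))))
    (h : ∀ n, inner ℂ (tensorLp 0 n) u = 0) : u = 0 := by
  set v : EuclideanSpace ℝ (Fin d) → ℂ := fun x => (weightRoot 0 x : ℂ) * u x with hv
  have hvi : Integrable v := by
    have h0 : MemLp (fun x : EuclideanSpace ℝ (Fin d) => (weightRoot 0 x : ℂ)) 2 volume :=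
      (memLp_weightRoot 0).ofReal
    exact h0.integrable_mul (Lp.memLp u)
  have h1 : ∀ n : Fin d → ℕ, ∫ x, (∏ i, (normT (n i)).eval (toUnit (x i))) • v x = 0 := by
    intro n
    rw [← h n, inner_tensorLp_left]
    congr 1 with x
    rw [hv, Complex.real_smul, ← mul_assoc, ← Complex.ofReal_mul, tensorDeriv, weightRoot,
      ← Finset.prod_mul_distrib]
    congr 2
    exact Finset.prod_congr rfl fun i _ => by simp [mul_comm]
  have h2 : v =ᵐ[volume] 0 := by
    refine ae_eq_zero_of_integral_contDiff_smul_eq_zero hvi.locallyIntegrable fun φ hφ hφc => ?_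
    obtain ⟨g, hg⟩ := exists_continuousMap_comp_toCube hφ.continuous hφc
    simp_rw [← hg]
    exact integral_comp_toCube_eq_zero hvi (integral_chebyshev_mul_eq_zero h1) g
  rw [Lp.eq_zero_iff_ae_eq_zero]
  filter_upwards [h2] with x hx
  exact (mul_eq_zero.1 hx).resolve_left (Complex.ofReal_ne_zero.2 (weightRoot_pos 0 x).ne')

/-- The tensor product mapped Chebyshev functions as a Hilbert basis of `L²(ℝᵈ)`. -/
def mcfBasis (d : ℕ) :
    HilbertBasis (Fin d → ℕ) ℂ (Lp ℂ 2 (volume : Measure (EuclideanSpace ℝ (Fin d)))) :=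
  HilbertBasis.mkOfOrthogonalEqBot orthonormal_tensorLp <| by
    rw [Submodule.eq_bot_iff]
    intro u hu
    refine eq_zero_of_forall_inner_tensorLp_eq_zero u fun n => ?_
    exact (Submodule.mem_orthogonal _ _).1 hu _ (Submodule.subset_span ⟨n, rfl⟩)

@[simp] theorem mcfBasis_apply (n : Fin d → ℕ) : mcfBasis d n = tensorLp 0 n := by
  simp [mcfBasis]

/-- The coefficients of `π_N^d u - u` vanish in the box `nⱼ ≤ N` and are those of `-u` outside. -/
theorem inner_tensorLp_mcfProj_sub (N : ℕ)
    (u : Lp ℂ 2 (volume : Measure (EuclideanSpace ℝ (Fin d)))) (n : Fin d → ℕ) :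
    inner ℂ (tensorLp 0 n) (mcfProj d N u - u) =
      if ∀ j, n j ≤ N then 0 else -inner ℂ (tensorLp 0 n) u := by
  split_ifs with hn
  · have hmem : tensorLp 0 n ∈ mcfSpace d N := by
      rw [tensorLp_zero]
      exact Submodule.subset_span ⟨fun j => ⟨n j, Nat.lt_succ_of_le (hn j)⟩, rfl⟩
    have h := Submodule.starProjection_inner_eq_zero (K := mcfSpace d N) u _ hmem
    rw [← inner_conj_symm] at h
    have h' := (map_eq_zero _).1 h
    rw [← neg_sub, inner_neg_right]
    simpa [mcfProj] using h'
  · rw [inner_sub_right, sub_eq_neg_self]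
    have hle : mcfSpace d N ≤ (Submodule.span ℂ {tensorLp 0 n})ᗮ := by
      refine Submodule.span_le.2 ?_
      rintro _ ⟨k, rfl⟩
      rw [SetLike.mem_coe, Submodule.mem_orthogonal_singleton_iff_inner_right]
      dsimp only
      rw [← tensorLp_zero, orthonormal_tensorLp.2]
      rintro rfl
      exact hn fun j => Nat.lt_succ_iff.1 (k j).2
    exact Submodule.mem_orthogonal_singleton_iff_inner_right.1
      (hle (Submodule.starProjection_apply_mem _ u))

/-! ### The Fourier transform and weak derivatives -/

/-- If `∂_v f = g` as tempered distributions with `f, g ∈ L²`, then `ĝ(ξ) = 2πi ⟨ξ, v⟩ f̂(ξ)`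
almost everywhere. -/
theorem fourier_ae_eq_of_lineDeriv_eq
    {f g : Lp ℂ 2 (volume : Measure (EuclideanSpace ℝ (Fin d)))} (v : EuclideanSpace ℝ (Fin d))
    (h : LineDeriv.lineDerivOp v (Lp.toTemperedDistribution f) = Lp.toTemperedDistribution g) :
    ∀ᵐ ξ, (𝓕 g : Lp ℂ 2 (volume : Measure (EuclideanSpace ℝ (Fin d)))) ξ =
      (2 * Real.pi * Complex.I) * ((inner ℝ ξ v : ℝ) : ℂ) *
        (𝓕 f : Lp ℂ 2 (volume : Measure (EuclideanSpace ℝ (Fin d)))) ξ := by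
  have h1 := TemperedDistribution.fourier_lineDerivOp_eq (Lp.toTemperedDistribution f) v
  rw [h, Lp.fourier_toTemperedDistribution_eq, Lp.fourier_toTemperedDistribution_eq] at h1
  have hloc : ∀ e : Lp ℂ 2 (volume : Measure (EuclideanSpace ℝ (Fin d))),
      LocallyIntegrable e := fun e => (Lp.memLp e).locallyIntegrable (by norm_num)
  have hcont : Continuous fun ξ : EuclideanSpace ℝ (Fin d) =>
      (2 * Real.pi * Complex.I) * ((inner ℝ ξ v : ℝ) : ℂ) := by fun_prop
  refine ae_eq_of_integral_contDiff_smul_eq (hloc _) ?_ fun φ hφ hφc => ?_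
  · have := (hloc (𝓕 f)).locallyIntegrableOn Set.univ
    rw [← locallyIntegrableOn_univ]
    exact this.continuousOn_mul hcont.continuousOn isOpen_univ.isLocallyClosed
  have hg₁ : HasCompactSupport (Complex.ofRealCLM ∘ φ) := hφc.comp_left rfl
  have hg₂ : ContDiff ℝ ∞ (Complex.ofRealCLM ∘ φ) := by fun_prop
  have h2 := DFunLike.congr_fun h1 (hg₁.toSchwartzMap hg₂)
  have htg : Function.HasTemperateGrowth fun x : EuclideanSpace ℝ (Fin d) =>
    ((inner ℝ x v : ℝ) : ℂ) := by fun_prop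
  rw [Lp.toTemperedDistribution_apply] at h2
  change _ = (2 * Real.pi * Complex.I) • (TemperedDistribution.smulLeftCLM ℂ _ _) _ at h2
  rw [TemperedDistribution.smulLeftCLM_apply_apply, Lp.toTemperedDistribution_apply,
    ← integral_smul] at h2
  simp only [SchwartzMap.smulLeftCLM_apply_apply htg, smul_eq_mul] at h2
  have h3 : ∀ x, (hg₁.toSchwartzMap hg₂) x = (φ x : ℂ) := fun x => rfl
  simp only [h3] at h2
  simp only [Complex.real_smul]
  rw [h2]
  congr 1 with x
  ring

theorem contDiff_tensorDeriv (k n : Fin d → ℕ) : ContDiff ℝ ∞ (tensorDeriv k n) := by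
  refine contDiff_prod fun i _ => ?_
  have h1 : ContDiff ℝ ∞ fun x : EuclideanSpace ℝ (Fin d) => x i := by fun_prop
  have h2 : ContDiff ℝ ∞ fun y : ℝ => (derivative^[k i] (normT (n i))).eval y := by
    simpa using! (derivative^[k i] (normT (n i))).contDiff_aeval ∞
  exact ((contDiff_decay.comp h1).pow _).mul (h2.comp (contDiff_toUnit.comp h1))

theorem exists_abs_tensorDeriv_le (k n : Fin d → ℕ) : ∃ C, ∀ x, |tensorDeriv k n x| ≤ C := by
  choose C hC0 hC using fun i => exists_abs_eval_toUnit_le (derivative^[k i] (normT (n i)))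
  refine ⟨∏ i, C i, fun x => ?_⟩
  rw [tensorDeriv, Finset.abs_prod]
  refine Finset.prod_le_prod (fun _ _ => abs_nonneg _) fun i _ => ?_
  rw [abs_mul, abs_of_nonneg (pow_nonneg (decay_pos _).le _)]
  exact (mul_le_of_le_one_left (abs_nonneg _)
    (pow_le_one₀ (decay_pos _).le (decay_le_one _))).trans (hC i _)

/-- `∂ᵢ` of a tensor product mapped Chebyshev function, in terms of the two orthogonal families
`tensorDeriv 0` and `tensorDeriv eᵢ`. -/
theorem fderiv_tensorDeriv_zero (i : Fin d) (n : Fin d → ℕ) (x : EuclideanSpace ℝ (Fin d)) :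
    fderiv ℝ (tensorDeriv 0 n) x (EuclideanSpace.single i 1) =
      -(toUnit (x i) * decay (x i)) * tensorDeriv 0 n x +
        decay (x i) ^ 2 * tensorDeriv (Pi.single i 1) n x := by
  have hd := (contDiff_tensorDeriv 0 n).differentiable (by simp) x
  rw [← hd.lineDeriv_eq_fderiv]
  set f : ℕ → ℝ → ℝ := fun l t => decay t * (normT l).eval (toUnit t)
  have hsplit : ∀ z : EuclideanSpace ℝ (Fin d), tensorDeriv 0 n z =
      f (n i) (z i) * ∏ l ∈ Finset.univ.erase i, f (n l) (z l) := by
    intro z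
    rw [Finset.mul_prod_erase Finset.univ (fun l => f (n l) (z l)) (Finset.mem_univ i)]
    simp [tensorDeriv, f]
  have hsplit' : tensorDeriv (Pi.single i 1) n x =
      decay (x i) ^ 2 * (derivative (normT (n i))).eval (toUnit (x i)) *
        ∏ l ∈ Finset.univ.erase i, f (n l) (x l) := by
    rw [tensorDeriv, ← Finset.mul_prod_erase Finset.univ _ (Finset.mem_univ i)]
    congr 1
    · simp
    · refine Finset.prod_congr rfl fun l hl => ?_
      simp [f, Pi.single_eq_of_ne (Finset.ne_of_mem_erase hl)]
  have hline : (fun s : ℝ => tensorDeriv 0 n (x + s • EuclideanSpace.single i 1)) =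
      fun s => f (n i) (x i + s) * ∏ l ∈ Finset.univ.erase i, f (n l) (x l) := by
    ext s
    rw [hsplit]
    congr 1
    · simp
    · refine Finset.prod_congr rfl fun l hl => ?_
      simp [Finset.ne_of_mem_erase hl]
  have hder : HasDerivAt (fun s => f (n i) (x i + s))
      (-(toUnit (x i) * decay (x i) ^ 2) * (normT (n i)).eval (toUnit (x i)) +
        decay (x i) * (decay (x i) ^ 3 * (derivative (normT (n i))).eval (toUnit (x i)))) 0 := by
    have h0 := (hasDerivAt_decay (x i)).mul (hasDerivAt_eval_toUnit (normT (n i)) (x i))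
    rw [← add_zero (x i)] at h0
    simpa only [add_zero] using! h0.comp_const_add (x i) 0
  rw [lineDeriv, hline, (hder.mul_const _).deriv, hsplit, hsplit']
  simp only [f]
  ring

theorem memLp_bdd_mul {b : EuclideanSpace ℝ (Fin d) → ℝ} (hb : Continuous b)
    (hb1 : ∀ x, |b x| ≤ 1) (f : Lp ℂ 2 (volume : Measure (EuclideanSpace ℝ (Fin d)))) :
    MemLp (fun x => (b x : ℂ) * f x) 2 volume := by
  refine (Lp.memLp f).of_le ((Complex.continuous_ofReal.comp hb).aestronglyMeasurable.mul
    (Lp.aestronglyMeasurable f)) (Eventually.of_forall fun x => ?_)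
  rw [norm_mul, Complex.norm_real]
  exact mul_le_of_le_one_left (norm_nonneg _) (hb1 x)

/-- Multiplication by a continuous real function bounded by `1`, as a contraction of `L²`. -/
def mulContraction (b : EuclideanSpace ℝ (Fin d) → ℝ) (hb : Continuous b) (hb1 : ∀ x, |b x| ≤ 1) :
    Lp ℂ 2 (volume : Measure (EuclideanSpace ℝ (Fin d))) →L[ℂ]
      Lp ℂ 2 (volume : Measure (EuclideanSpace ℝ (Fin d))) :=
  LinearMap.mkContinuous
    { toFun := fun f => (memLp_bdd_mul hb hb1 f).toLp
      map_add' := fun f g => by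
        rw [← MemLp.toLp_add]
        refine MemLp.toLp_congr _ _ ?_
        filter_upwards [Lp.coeFn_add f g] with x hx
        rw [hx, Pi.add_apply, Pi.add_apply, mul_add]
      map_smul' := fun c f => by
        rw [RingHom.id_apply, ← MemLp.toLp_const_smul]
        refine MemLp.toLp_congr _ _ ?_
        filter_upwards [Lp.coeFn_smul c f] with x hx
        rw [hx, Pi.smul_apply, Pi.smul_apply, smul_eq_mul, smul_eq_mul, mul_left_comm] }
    1 fun f => by
      rw [one_mul]
      refine Lp.norm_le_norm_of_ae_le ?_
      filter_upwards [(memLp_bdd_mul hb hb1 f).coeFn_toLp] with x hx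
      rw [LinearMap.coe_mk, AddHom.coe_mk, hx, norm_mul, Complex.norm_real]
      exact mul_le_of_le_one_left (norm_nonneg _) (hb1 x)

theorem coeFn_mulContraction {b : EuclideanSpace ℝ (Fin d) → ℝ} (hb : Continuous b)
    (hb1 : ∀ x, |b x| ≤ 1) (f : Lp ℂ 2 (volume : Measure (EuclideanSpace ℝ (Fin d)))) :
    mulContraction b hb hb1 f =ᵐ[volume] fun x => (b x : ℂ) * f x :=
  (memLp_bdd_mul hb hb1 f).coeFn_toLp

theorem norm_mulContraction_le {b : EuclideanSpace ℝ (Fin d) → ℝ} (hb : Continuous b)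
    (hb1 : ∀ x, |b x| ≤ 1) (f : Lp ℂ 2 (volume : Measure (EuclideanSpace ℝ (Fin d)))) :
    ‖mulContraction b hb hb1 f‖ ≤ ‖f‖ := by
  refine Lp.norm_le_norm_of_ae_le ?_
  filter_upwards [coeFn_mulContraction hb hb1 f] with x hx
  rw [hx, norm_mul, Complex.norm_real]
  exact mul_le_of_le_one_left (norm_nonneg _) (hb1 x)

theorem continuous_neg_toUnit_mul_decay (i : Fin d) :
    Continuous fun x : EuclideanSpace ℝ (Fin d) => -(toUnit (x i) * decay (x i)) :=
  ((continuous_toUnit.comp (continuous_coord i)).mul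
    (continuous_decay.comp (continuous_coord i))).neg

theorem abs_neg_toUnit_mul_decay_le (i : Fin d) (x : EuclideanSpace ℝ (Fin d)) :
    |-(toUnit (x i) * decay (x i))| ≤ 1 := by
  rw [abs_neg, abs_mul, abs_of_pos (decay_pos _)]
  exact mul_le_one₀ (abs_toUnit_le_one _) (decay_pos _).le (decay_le_one _)

theorem continuous_decay_sq (i : Fin d) :
    Continuous fun x : EuclideanSpace ℝ (Fin d) => decay (x i) ^ 2 :=
  (continuous_decay.comp (continuous_coord i)).pow 2

theorem abs_decay_sq_le (i : Fin d) (x : EuclideanSpace ℝ (Fin d)) : |decay (x i) ^ 2| ≤ 1 := by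
  rw [abs_of_nonneg (sq_nonneg _)]
  exact pow_le_one₀ (decay_pos _).le (decay_le_one _)

/-- The operator sending the pair `(Σ cₙ tensorDeriv 0 n, Σ cₙ tensorDeriv eᵢ n)` to the partial
derivative `∂ᵢ` of its first entry. -/
def partialLp (i : Fin d) (f g : Lp ℂ 2 (volume : Measure (EuclideanSpace ℝ (Fin d)))) :
    Lp ℂ 2 (volume : Measure (EuclideanSpace ℝ (Fin d))) :=
  mulContraction _ (continuous_neg_toUnit_mul_decay i) (abs_neg_toUnit_mul_decay_le i) f +
    mulContraction _ (continuous_decay_sq i) (abs_decay_sq_le i) g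

/-- The classical partial derivative of a tensor product mapped Chebyshev function is its
distributional one: integration by parts against a Schwartz function, all factors being bounded. -/
theorem lineDeriv_tensorLp (i : Fin d) (n : Fin d → ℕ) :
    LineDeriv.lineDerivOp (EuclideanSpace.single i (1 : ℝ))
      (Lp.toTemperedDistribution (tensorLp 0 n)) =
      Lp.toTemperedDistribution (partialLp i (tensorLp 0 n) (tensorLp (Pi.single i 1) n)) := by
  ext φ
  rw [TemperedDistribution.lineDerivOp_apply_apply, Lp.toTemperedDistribution_apply,
    Lp.toTemperedDistribution_apply]
  set F : EuclideanSpace ℝ (Fin d) → ℂ := fun x => (tensorDeriv 0 n x : ℂ) with hF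
  have hFd : ∀ x, HasFDerivAt F (Complex.ofRealCLM.comp (fderiv ℝ (tensorDeriv 0 n) x)) x :=
    fun x => Complex.ofRealCLM.hasFDerivAt.comp x
      ((contDiff_tensorDeriv 0 n).differentiable (by simp) x).hasFDerivAt
  have hFv : ∀ x, fderiv ℝ F x (EuclideanSpace.single i 1) =
      ((-(toUnit (x i) * decay (x i)) : ℝ) : ℂ) * (tensorDeriv 0 n x : ℂ) +
        ((decay (x i) ^ 2 : ℝ) : ℂ) * (tensorDeriv (Pi.single i 1) n x : ℂ) := by
    intro x
    rw [(hFd x).fderiv, ContinuousLinearMap.comp_apply, fderiv_tensorDeriv_zero]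
    simp
  obtain ⟨C₀, hC₀⟩ := exists_abs_tensorDeriv_le 0 n
  obtain ⟨C₁, hC₁⟩ := exists_abs_tensorDeriv_le (Pi.single i 1) n
  have hFcont : Continuous F := Complex.continuous_ofReal.comp (continuous_tensorDeriv 0 n)
  have hFb : ∀ x, ‖F x‖ ≤ C₀ := fun x => by rw [hF, Complex.norm_real]; exact hC₀ x
  have hφ := φ.integrable (μ := volume)
  have hφ' := (LineDeriv.lineDerivOp (EuclideanSpace.single i (1 : ℝ)) φ).integrable (μ := volume)
  have hφv : ∀ x, (LineDeriv.lineDerivOp (EuclideanSpace.single i (1 : ℝ)) φ) x =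
      fderiv ℝ φ x (EuclideanSpace.single i 1) := SchwartzMap.lineDerivOp_apply_eq_fderiv _ φ
  have hF'c : Continuous fun x => fderiv ℝ F x (EuclideanSpace.single i 1) := by
    have hc := continuous_neg_toUnit_mul_decay i
    have hc' := continuous_decay_sq i
    have hc0 := continuous_tensorDeriv 0 n
    have hc1 := continuous_tensorDeriv (Pi.single i 1) n
    simp_rw [hFv]
    exact ((Complex.continuous_ofReal.comp hc).mul (Complex.continuous_ofReal.comp hc0)).add
      ((Complex.continuous_ofReal.comp hc').mul (Complex.continuous_ofReal.comp hc1))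
  have hF'b : ∀ x, ‖fderiv ℝ F x (EuclideanSpace.single i 1)‖ ≤ C₀ + C₁ := by
    intro x
    rw [hFv]
    refine (norm_add_le _ _).trans (add_le_add ?_ ?_)
    · rw [norm_mul, Complex.norm_real, Complex.norm_real]
      exact (mul_le_of_le_one_left (norm_nonneg _) (abs_neg_toUnit_mul_decay_le i x)).trans (hC₀ x)
    · rw [norm_mul, Complex.norm_real, Complex.norm_real]
      exact (mul_le_of_le_one_left (norm_nonneg _) (abs_decay_sq_le i x)).trans (hC₁ x)
  have hparts := integral_mul_fderiv_eq_neg_fderiv_mul_of_integrable (μ := volume)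
    (f := F) (g := φ) (v := EuclideanSpace.single i (1 : ℝ))
    (hφ.bdd_smul (C₀ + C₁) hF'c.aestronglyMeasurable (Eventually.of_forall hF'b))
    (by
      simp_rw [← hφv]
      exact hφ'.bdd_smul C₀ hFcont.aestronglyMeasurable (Eventually.of_forall hFb))
    (hφ.bdd_smul C₀ hFcont.aestronglyMeasurable (Eventually.of_forall hFb))
    (fun x _ => (hFd x).differentiableAt) (fun x _ => φ.differentiable x)
  have e1 : ∫ x, (-LineDeriv.lineDerivOp (EuclideanSpace.single i (1 : ℝ)) φ) x •
      tensorLp 0 n x = -∫ x, F x * fderiv ℝ φ x (EuclideanSpace.single i 1) := by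
    rw [← integral_neg]
    refine integral_congr_ae ?_
    filter_upwards [coeFn_tensorLp 0 n] with x hx
    rw [hx, ← hφv, neg_apply, smul_eq_mul, neg_mul, mul_comm]
  rw [e1, hparts, neg_neg]
  refine integral_congr_ae ?_
  filter_upwards [coeFn_tensorLp 0 n, coeFn_tensorLp (Pi.single i 1) n,
    Lp.coeFn_add (mulContraction _ (continuous_neg_toUnit_mul_decay i)
      (abs_neg_toUnit_mul_decay_le i) (tensorLp 0 n)) (mulContraction _ (continuous_decay_sq i)
      (abs_decay_sq_le i) (tensorLp (Pi.single i 1) n)),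
    coeFn_mulContraction (continuous_neg_toUnit_mul_decay i) (abs_neg_toUnit_mul_decay_le i)
      (tensorLp 0 n),
    coeFn_mulContraction (continuous_decay_sq i) (abs_decay_sq_le i)
      (tensorLp (Pi.single i 1) n)] with x h1 h2 h3 h4 h5
  rw [partialLp, h3, Pi.add_apply, h4, h5, h1, h2, hFv, smul_eq_mul, mul_comm]

theorem lineDeriv_sum_tensorLp (i : Fin d) (S : Finset (Fin d → ℕ)) (c : (Fin d → ℕ) → ℂ) :
    LineDeriv.lineDerivOp (EuclideanSpace.single i (1 : ℝ))
      (Lp.toTemperedDistribution (∑ n ∈ S, c n • tensorLp 0 n)) =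
      Lp.toTemperedDistribution (partialLp i (∑ n ∈ S, c n • tensorLp 0 n)
        (∑ n ∈ S, c n • tensorLp (Pi.single i 1) n)) := by
  have h : partialLp i (∑ n ∈ S, c n • tensorLp 0 n) (∑ n ∈ S, c n • tensorLp (Pi.single i 1) n) =
      ∑ n ∈ S, c n • partialLp i (tensorLp 0 n) (tensorLp (Pi.single i 1) n) := by
    simp only [partialLp, map_sum, map_smul, smul_add, Finset.sum_add_distrib]
  rw [h]
  simp only [← Lp.toTemperedDistributionCLM_apply, map_sum, map_smul]
  simp only [Lp.toTemperedDistributionCLM_apply, ← lineDeriv_tensorLp]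
  rw [← LineDeriv.lineDerivOpCLM_apply (R := ℂ), map_sum]
  simp only [map_smul, LineDeriv.lineDerivOpCLM_apply]

/-- The squared `L²` norm of the gradient, `∫ |2πη|² |û(η)|² dη`, possibly infinite. -/
def gradEnergy (u : Lp ℂ 2 (volume : Measure (EuclideanSpace ℝ (Fin d)))) : ℝ≥0∞ :=
  ∫⁻ η, ENNReal.ofReal ((2 * Real.pi * ‖η‖) ^ 2) *
    ‖(𝓕 u : Lp ℂ 2 (volume : Measure (EuclideanSpace ℝ (Fin d)))) η‖ₑ ^ 2

theorem lintegral_enorm_sq (f : Lp ℂ 2 (volume : Measure (EuclideanSpace ℝ (Fin d)))) :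
    ∫⁻ x, ‖f x‖ₑ ^ 2 = ENNReal.ofReal (‖f‖ ^ 2) := by
  have h := Lp.enorm_def f
  rw [eLpNorm_eq_lintegral_rpow_enorm_toReal (by norm_num) (by norm_num)] at h
  have h2 : ‖f‖ₑ ^ 2 = ∫⁻ x, ‖f x‖ₑ ^ 2 := by
    rw [h, ← ENNReal.rpow_natCast, ← ENNReal.rpow_mul]
    norm_num
  rw [← h2, ENNReal.ofReal_pow (norm_nonneg _), ofReal_norm]

/-- By Plancherel the gradient energy is the sum of the squared `L²` norms of the partial
derivatives, which `partialLp` bounds by two orthogonal sums. -/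
theorem gradEnergy_sum_tensorLp_le (S : Finset (Fin d → ℕ)) (c : (Fin d → ℕ) → ℂ) :
    gradEnergy (∑ n ∈ S, c n • tensorLp 0 n) ≤
      ENNReal.ofReal (∑ n ∈ S, 2 * (d + ∑ i, (n i : ℝ) ^ 2) * ‖c n‖ ^ 2) := by
  classical
  set f := ∑ n ∈ S, c n • tensorLp 0 n
  set g : Fin d → Lp ℂ 2 (volume : Measure (EuclideanSpace ℝ (Fin d))) := fun i =>
    partialLp i f (∑ n ∈ S, c n • tensorLp (Pi.single i 1) n)
  have hg : ∀ i, ‖g i‖ ^ 2 ≤ ∑ n ∈ S, 2 * (1 + (n i : ℝ) ^ 2) * ‖c n‖ ^ 2 := by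
    intro i
    have h1 : ‖g i‖ ≤ ‖f‖ + ‖∑ n ∈ S, c n • tensorLp (Pi.single i 1) n‖ :=
      (norm_add_le _ _).trans (add_le_add (norm_mulContraction_le _ _ _)
        (norm_mulContraction_le _ _ _))
    have h2 := norm_sq_sum_of_orthogonal (inner_tensorLp (0 : Fin d → ℕ)) S c
    have h3 := norm_sq_sum_of_orthogonal (inner_tensorLp (Pi.single i 1 : Fin d → ℕ)) S c
    simp only [prod_eigen_single, eigen_one] at h3
    simp only [Pi.zero_apply, eigen_zero, Finset.prod_const_one, one_mul] at h2
    have h4 : ∑ n ∈ S, 2 * (1 + (n i : ℝ) ^ 2) * ‖c n‖ ^ 2 =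
        2 * (∑ n ∈ S, ‖c n‖ ^ 2 + ∑ n ∈ S, (n i : ℝ) ^ 2 * ‖c n‖ ^ 2) := by
      rw [← Finset.sum_add_distrib, Finset.mul_sum]
      exact Finset.sum_congr rfl fun n _ => by ring
    rw [h4, ← h2, ← h3]
    have := pow_le_pow_left₀ (norm_nonneg _) h1 2
    nlinarith [sq_nonneg (‖f‖ - ‖∑ n ∈ S, c n • tensorLp (Pi.single i 1) n‖)]
  have hF : ∀ᵐ ξ, ENNReal.ofReal ((2 * Real.pi * ‖ξ‖) ^ 2) *
      ‖(𝓕 f : Lp ℂ 2 (volume : Measure (EuclideanSpace ℝ (Fin d)))) ξ‖ₑ ^ 2 =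
      ∑ i, ‖(𝓕 (g i) : Lp ℂ 2 (volume : Measure (EuclideanSpace ℝ (Fin d)))) ξ‖ₑ ^ 2 := by
    have h := fun i => fourier_ae_eq_of_lineDeriv_eq _ (lineDeriv_sum_tensorLp i S c)
    filter_upwards [ae_all_iff.2 h] with ξ hξ
    have h1 : ∀ i, ‖(𝓕 (g i) : Lp ℂ 2 (volume : Measure (EuclideanSpace ℝ (Fin d)))) ξ‖ₑ ^ 2 =
        ENNReal.ofReal ((2 * Real.pi * ξ i) ^ 2) *
          ‖(𝓕 f : Lp ℂ 2 (volume : Measure (EuclideanSpace ℝ (Fin d)))) ξ‖ₑ ^ 2 := by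
      intro i
      have h2 : ‖(2 * Real.pi * Complex.I) *
          ((inner ℝ ξ (EuclideanSpace.single i (1 : ℝ)) : ℝ) : ℂ)‖ = |2 * Real.pi * ξ i| := by
        simp [EuclideanSpace.inner_single_right, abs_mul]
      rw [hξ i, enorm_mul, mul_pow, ← ofReal_norm (_ * _), h2, ← ENNReal.ofReal_pow (abs_nonneg _),
        sq_abs]
    simp_rw [h1]
    rw [← Finset.sum_mul, ← ENNReal.ofReal_sum_of_nonneg fun _ _ => sq_nonneg _, mul_pow,
      EuclideanSpace.norm_sq_eq, Finset.mul_sum]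
    simp only [mul_pow, Real.norm_eq_abs, sq_abs]
  rw [gradEnergy, lintegral_congr_ae hF, lintegral_finsetSum' _ fun i _ =>
    ((Lp.aestronglyMeasurable _).enorm.pow_const 2)]
  simp_rw [lintegral_enorm_sq, Lp.norm_fourier_eq]
  rw [← ENNReal.ofReal_sum_of_nonneg fun _ _ => sq_nonneg _]
  refine ENNReal.ofReal_le_ofReal ((Finset.sum_le_sum fun i _ => hg i).trans_eq ?_)
  rw [Finset.sum_comm]
  refine Finset.sum_congr rfl fun n _ => ?_
  rw [← Finset.sum_mul, ← Finset.mul_sum, Finset.sum_add_distrib]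
  simp

/-- The gradient energy is lower semicontinuous along the Chebyshev expansion. -/
theorem gradEnergy_le_of_forall_sum_le
    (u : Lp ℂ 2 (volume : Measure (EuclideanSpace ℝ (Fin d)))) {B : ℝ}
    (h : ∀ S : Finset (Fin d → ℕ),
      ∑ n ∈ S, 2 * (d + ∑ i, (n i : ℝ) ^ 2) * ‖inner ℂ (tensorLp 0 n) u‖ ^ 2 ≤ B) :
    gradEnergy u ≤ ENNReal.ofReal B := by
  have hs := (mcfBasis d).hasSum_repr u
  simp only [HilbertBasis.repr_apply_apply, mcfBasis_apply] at hs
  obtain ⟨S, hS⟩ := exists_seq_tendsto (atTop : Filter (Finset (Fin d → ℕ)))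
  have h1 := hs.comp hS
  have h2 := ((Lp.fourierTransformₗᵢ (EuclideanSpace ℝ (Fin d)) ℂ).continuous.tendsto u).comp h1
  obtain ⟨ns, hns, hae⟩ := (tendstoInMeasure_of_tendsto_Lp h2).exists_seq_tendsto_ae
  set F : ℕ → Lp ℂ 2 (volume : Measure (EuclideanSpace ℝ (Fin d))) := fun l =>
    ∑ n ∈ S (ns l), (inner ℂ (tensorLp 0 n) u : ℂ) • tensorLp 0 n
  have h3 : gradEnergy u ≤ ∫⁻ η, liminf (fun l => ENNReal.ofReal ((2 * Real.pi * ‖η‖) ^ 2) *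
      ‖(𝓕 (F l) : Lp ℂ 2 (volume : Measure (EuclideanSpace ℝ (Fin d)))) η‖ₑ ^ 2) atTop := by
    refine lintegral_mono_ae ?_
    filter_upwards [hae] with η hη
    have h4 : Tendsto (fun l => ‖(𝓕 (F l) : Lp ℂ 2
        (volume : Measure (EuclideanSpace ℝ (Fin d)))) η‖ₑ ^ 2) atTop
        (𝓝 (‖(𝓕 u : Lp ℂ 2 (volume : Measure (EuclideanSpace ℝ (Fin d)))) η‖ₑ ^ 2)) :=
      ENNReal.Tendsto.pow hη.enorm
    exact (ENNReal.Tendsto.const_mul h4 (Or.inr ENNReal.ofReal_ne_top)).liminf_eq.ge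
  refine h3.trans ((lintegral_liminf_le' fun l => ?_).trans ?_)
  · have hc : Measurable fun η : EuclideanSpace ℝ (Fin d) =>
        ENNReal.ofReal ((2 * Real.pi * ‖η‖) ^ 2) := by fun_prop
    exact hc.aemeasurable.mul ((Lp.aestronglyMeasurable _).enorm.pow_const 2)
  · refine liminf_le_of_frequently_le' (Frequently.of_forall fun l => ?_)
    exact (gradEnergy_sum_tensorLp_le _ _).trans (ENNReal.ofReal_le_ofReal (h _))

/-! ### The error estimate -/

theorem norm_sq_le_of_forall_sum_le
    (u : Lp ℂ 2 (volume : Measure (EuclideanSpace ℝ (Fin d)))) {B : ℝ}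
    (h : ∀ S : Finset (Fin d → ℕ), ∑ n ∈ S, ‖inner ℂ (tensorLp 0 n) u‖ ^ 2 ≤ B) :
    ‖u‖ ^ 2 ≤ B := by
  classical
  have hs := (mcfBasis d).hasSum_repr u
  simp only [HilbertBasis.repr_apply_apply, mcfBasis_apply] at hs
  refine le_of_tendsto ((Tendsto.norm hs).pow 2) (Eventually.of_forall fun S => ?_)
  rw [norm_sq_sum_of_orthogonal (inner_tensorLp 0)]
  simpa using h S

/-- Interpolation between the orders `0` and `1` by Young's inequality, with the scale `N`. -/
theorem one_add_rpow_le {N s r : ℝ} (hN : 1 ≤ N) (hs : 0 ≤ s) (hs1 : s ≤ 1) (hr : 0 ≤ r) :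
    1 + r ^ (2 * s) ≤ N ^ (2 * s) * (2 + (N ^ 2)⁻¹ * r ^ 2) := by
  have hN0 : 0 < N := by linarith
  set t := r / N with ht
  have ht0 : 0 ≤ t := by positivity
  have hrt : r = N * t := by rw [ht]; field_simp
  have h1 : t ^ (2 * s) ≤ 1 + t ^ 2 := by
    rcases le_or_gt t 1 with h | h
    · exact (Real.rpow_le_one ht0 h (by positivity)).trans (by nlinarith)
    · have := Real.rpow_le_rpow_of_exponent_le h.le (show 2 * s ≤ (2 : ℕ) by push_cast; linarith)
      rw [Real.rpow_natCast] at this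
      linarith
  have h2 : (1 : ℝ) ≤ N ^ (2 * s) := Real.one_le_rpow hN (by positivity)
  have h3 : (N ^ 2)⁻¹ * r ^ 2 = t ^ 2 := by rw [ht, div_pow]; field_simp
  rw [h3, hrt, Real.mul_rpow hN0.le ht0]
  nlinarith

/-- The Sobolev norm in terms of the transform with kernel `exp(-2πi η·x)`. -/
theorem sobolevNorm_eq (s : ℝ) (u : Lp ℂ 2 (volume : Measure (EuclideanSpace ℝ (Fin d)))) :
    sobolevNorm s u = (∫⁻ η, ENNReal.ofReal (1 + (2 * Real.pi * ‖η‖) ^ (2 * s)) *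
      ‖(𝓕 u : Lp ℂ 2 (volume : Measure (EuclideanSpace ℝ (Fin d)))) η‖ₑ ^ 2) ^ (1 / 2 : ℝ) := by
  have hpi : (0 : ℝ) < 2 * Real.pi := by positivity
  set U : EuclideanSpace ℝ (Fin d) → ℂ :=
    fun η => (𝓕 u : Lp ℂ 2 (volume : Measure (EuclideanSpace ℝ (Fin d)))) η with hU
  have hUm : Measurable U := (Lp.stronglyMeasurable _).measurable
  set G : EuclideanSpace ℝ (Fin d) → ℝ≥0∞ := fun η =>
    ENNReal.ofReal (1 + (2 * Real.pi * ‖η‖) ^ (2 * s)) * ‖U η‖ₑ ^ 2 with hG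
  have hGm : Measurable G := by
    have h1 : Measurable fun η : EuclideanSpace ℝ (Fin d) =>
      ENNReal.ofReal (1 + (2 * Real.pi * ‖η‖) ^ (2 * s)) := by fun_prop
    exact h1.mul (hUm.enorm.pow_const 2)
  have hp : (((2 * Real.pi) ^ (-(d : ℝ) / 2)) ^ 2 : ℝ) = ((2 * Real.pi) ^ d)⁻¹ := by
    rw [← Real.rpow_natCast, ← Real.rpow_mul hpi.le, ← Real.rpow_natCast _ d,
      ← Real.rpow_neg hpi.le]
    congr 1
    push_cast
    ring
  have hpt : ∀ ξ : EuclideanSpace ℝ (Fin d),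
      ENNReal.ofReal ((1 + ‖ξ‖ ^ (2 * s)) * ‖fourierUnitary u ξ‖ ^ 2) =
        ENNReal.ofReal ((2 * Real.pi) ^ d)⁻¹ * G ((2 * Real.pi)⁻¹ • ξ) := by
    intro ξ
    have h1 : 2 * Real.pi * ‖(2 * Real.pi)⁻¹ • ξ‖ = ‖ξ‖ := by
      rw [norm_smul, Real.norm_of_nonneg (by positivity)]
      field_simp
    have h2 : fourierUnitary u ξ =
      (((2 * Real.pi) ^ (-(d : ℝ) / 2) : ℝ) : ℂ) * U ((2 * Real.pi)⁻¹ • ξ) := rfl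
    have h3 : 0 ≤ 1 + ‖ξ‖ ^ (2 * s) := by positivity
    simp only [hG]
    rw [h1, h2, norm_mul, mul_pow, Complex.norm_real, Real.norm_eq_abs, sq_abs, hp,
      ← ofReal_norm (U _), ← ENNReal.ofReal_pow (norm_nonneg _), ← ENNReal.ofReal_mul h3,
      ← ENNReal.ofReal_mul (by positivity)]
    congr 1
    ring
  rw [sobolevNorm]
  congr 1
  simp_rw [hpt]
  have hcm : Measurable fun ξ : EuclideanSpace ℝ (Fin d) => (2 * Real.pi)⁻¹ • ξ := by fun_prop
  have hGc : Measurable fun ξ => G ((2 * Real.pi)⁻¹ • ξ) := hGm.comp hcm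
  rw [lintegral_const_mul _ hGc, ← lintegral_map hGm hcm,
    Measure.map_addHaar_smul _ (inv_ne_zero hpi.ne'), lintegral_smul_measure, smul_eq_mul,
    ← mul_assoc, ← ENNReal.ofReal_mul (by positivity), finrank_euclideanSpace_fin]
  rw [inv_pow, inv_inv, abs_of_pos (by positivity), inv_mul_cancel₀ (by positivity),
    ENNReal.ofReal_one, one_mul]

theorem sobolevNorm_le {s : ℝ} (hs : 0 ≤ s) (hs1 : s ≤ 1) {N : ℝ} (hN : 1 ≤ N)
    (u : Lp ℂ 2 (volume : Measure (EuclideanSpace ℝ (Fin d)))) {B₀ B₁ : ℝ} (hB₁ : 0 ≤ B₁)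
    (h0 : ‖u‖ ^ 2 ≤ B₀) (h1 : gradEnergy u ≤ ENNReal.ofReal B₁) :
    sobolevNorm s u ≤
      ENNReal.ofReal (√(N ^ (2 * s) * (2 * B₀ + (N ^ 2)⁻¹ * B₁))) := by
  have hB₀ : 0 ≤ B₀ := (sq_nonneg _).trans h0
  have hN0 : 0 < N := by linarith
  rw [sobolevNorm_eq, Real.sqrt_eq_rpow,
    ← ENNReal.ofReal_rpow_of_nonneg (by positivity) (by norm_num)]
  refine ENNReal.rpow_le_rpow ?_ (by norm_num)
  set U : EuclideanSpace ℝ (Fin d) → ℂ :=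
    fun η => (𝓕 u : Lp ℂ 2 (volume : Measure (EuclideanSpace ℝ (Fin d)))) η with hU
  have hUm : Measurable fun η => ‖U η‖ₑ ^ 2 :=
    (Lp.stronglyMeasurable _).measurable.enorm.pow_const 2
  have hc : Measurable fun η : EuclideanSpace ℝ (Fin d) =>
    ENNReal.ofReal ((2 * Real.pi * ‖η‖) ^ 2) := by fun_prop
  calc ∫⁻ η, ENNReal.ofReal (1 + (2 * Real.pi * ‖η‖) ^ (2 * s)) * ‖U η‖ₑ ^ 2
      ≤ ∫⁻ η, ENNReal.ofReal (N ^ (2 * s)) * (2 * ‖U η‖ₑ ^ 2 + ENNReal.ofReal (N ^ 2)⁻¹ *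
          (ENNReal.ofReal ((2 * Real.pi * ‖η‖) ^ 2) * ‖U η‖ₑ ^ 2)) := by
        refine lintegral_mono fun η => ?_
        have h := one_add_rpow_le hN hs hs1 (show 0 ≤ 2 * Real.pi * ‖η‖ by positivity)
        refine (mul_le_mul_left (ENNReal.ofReal_le_ofReal h) _).trans_eq ?_
        rw [ENNReal.ofReal_mul (by positivity), ENNReal.ofReal_add (by positivity) (by positivity),
          ENNReal.ofReal_mul (by positivity), ENNReal.ofReal_ofNat]
        ring
    _ = ENNReal.ofReal (N ^ (2 * s)) * (2 * ENNReal.ofReal (‖u‖ ^ 2) +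
          ENNReal.ofReal (N ^ 2)⁻¹ * gradEnergy u) := by
        rw [lintegral_const_mul' _ _ ENNReal.ofReal_ne_top,
          lintegral_add_left (hUm.const_mul _), lintegral_const_mul _ hUm,
          lintegral_const_mul' _ _ ENNReal.ofReal_ne_top, ← Lp.norm_fourier_eq u, ← lintegral_enorm_sq]
        rfl
    _ ≤ ENNReal.ofReal (N ^ (2 * s)) * (2 * ENNReal.ofReal B₀ +
          ENNReal.ofReal (N ^ 2)⁻¹ * ENNReal.ofReal B₁) := by
        gcongr
    _ = _ := by
        rw [ENNReal.ofReal_mul (by positivity), ENNReal.ofReal_add (by positivity) (by positivity),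
          ENNReal.ofReal_mul (by positivity), ENNReal.ofReal_mul (by positivity),
          ENNReal.ofReal_ofNat]

/-- For a frequency outside the box `nⱼ ≤ N` the eigenvalues of order `m` dominate `N^(2m)`. -/
theorem pow_le_sum_eigen {m N : ℕ} (hm : 1 ≤ m) (hmN : m ≤ N + 1) {n : Fin d → ℕ}
    (hn : ¬∀ j, n j ≤ N) : (N : ℝ) ^ (2 * m) ≤ (m : ℝ) ^ (2 * m) * ∑ j, eigen (n j) m := by
  push Not at hn
  obtain ⟨j, hj⟩ := hn
  have hm0 : (0 : ℝ) < m := by exact_mod_cast hm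
  have h1 := (pow_le_eigen hm (show m ≤ n j by omega)).trans
    (Finset.single_le_sum (f := fun j => eigen (n j) m) (fun j _ => eigen_nonneg _ _)
      (Finset.mem_univ j))
  rw [div_pow, div_le_iff₀' (by positivity)] at h1
  exact (pow_le_pow_left₀ (by positivity) (by exact_mod_cast hj.le) _).trans h1

/-- For a frequency outside the box `nⱼ ≤ N` the eigenvalues of order `m` dominate
`nᵢ² N^(2m - 2)` for every coordinate `i`, whether `nᵢ > N` or not. -/
theorem sq_mul_pow_le_sum_eigen {m N : ℕ} (hm : 1 ≤ m) (hmN : m ≤ N + 1) {n : Fin d → ℕ}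
    (hn : ¬∀ j, n j ≤ N) (i : Fin d) :
    (n i : ℝ) ^ 2 * (N : ℝ) ^ (2 * m) ≤
      (N : ℝ) ^ 2 * ((m : ℝ) ^ (2 * m) * ∑ j, eigen (n j) m) := by
  have hm0 : (0 : ℝ) < m := by exact_mod_cast hm
  rcases le_or_gt (n i) N with hi | hi
  · have hi' : (n i : ℝ) ≤ N := by exact_mod_cast hi
    exact mul_le_mul (pow_le_pow_left₀ (by positivity) hi' 2) (pow_le_sum_eigen hm hmN hn)
      (by positivity) (by positivity)
  · have hi' : (N : ℝ) ≤ n i := by exact_mod_cast hi.le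
    have h1 := (pow_le_eigen hm (show m ≤ n i by omega)).trans
      (Finset.single_le_sum (f := fun j => eigen (n j) m) (fun j _ => eigen_nonneg _ _)
        (Finset.mem_univ i))
    rw [div_pow, div_le_iff₀' (by positivity)] at h1
    obtain ⟨l, rfl⟩ : ∃ l, m = l + 1 := ⟨m - 1, by omega⟩
    calc (n i : ℝ) ^ 2 * (N : ℝ) ^ (2 * (l + 1))
        = (N : ℝ) ^ 2 * ((n i : ℝ) ^ 2 * (N : ℝ) ^ (2 * l)) := by ring
      _ ≤ (N : ℝ) ^ 2 * ((n i : ℝ) ^ 2 * (n i : ℝ) ^ (2 * l)) := by gcongr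
      _ = (N : ℝ) ^ 2 * (n i : ℝ) ^ (2 * (l + 1)) := by ring
      _ ≤ _ := by gcongr

theorem norm_sq_mcfProj_sub_le {m N : ℕ} (hm : 1 ≤ m) (hN : 1 ≤ N) (hmN : m ≤ N + 1)
    (u : Lp ℂ 2 (volume : Measure (EuclideanSpace ℝ (Fin d)))) (hu : MemB m u) :
    ‖mcfProj d N u - u‖ ^ 2 ≤ (m : ℝ) ^ (2 * m) / (N : ℝ) ^ (2 * m) * seminormB m u ^ 2 := by
  have hN0 : (0 : ℝ) < N := by exact_mod_cast hN
  refine norm_sq_le_of_forall_sum_le _ fun S => ?_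
  refine le_trans ?_ (mul_le_mul_of_nonneg_left (sum_sum_eigen_mul_le_seminormB_sq m u hu S)
    (by positivity))
  rw [Finset.mul_sum]
  refine Finset.sum_le_sum fun n _ => ?_
  have hpos : 0 ≤ ∑ j, eigen (n j) m := Finset.sum_nonneg fun j _ => eigen_nonneg _ _
  rw [inner_tensorLp_mcfProj_sub]
  split_ifs with hn
  · rw [norm_zero, zero_pow two_ne_zero]
    positivity
  · rw [norm_neg, ← mul_assoc]
    refine le_mul_of_one_le_left (sq_nonneg _) ?_
    rw [div_mul_eq_mul_div, one_le_div (by positivity)]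
    exact pow_le_sum_eigen hm hmN hn

theorem gradEnergy_mcfProj_sub_le {m N : ℕ} (hm : 1 ≤ m) (hN : 1 ≤ N) (hmN : m ≤ N + 1)
    (u : Lp ℂ 2 (volume : Measure (EuclideanSpace ℝ (Fin d)))) (hu : MemB m u) :
    gradEnergy (mcfProj d N u - u) ≤ ENNReal.ofReal
      (4 * d * (N : ℝ) ^ 2 * ((m : ℝ) ^ (2 * m) / (N : ℝ) ^ (2 * m) * seminormB m u ^ 2)) := by
  have hN0 : (0 : ℝ) < N := by exact_mod_cast hN
  have hN1 : (1 : ℝ) ≤ N := by exact_mod_cast hN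
  refine gradEnergy_le_of_forall_sum_le _ fun S => ?_
  rw [← mul_assoc]
  refine le_trans ?_ (mul_le_mul_of_nonneg_left (sum_sum_eigen_mul_le_seminormB_sq m u hu S)
    (by positivity))
  rw [Finset.mul_sum]
  refine Finset.sum_le_sum fun n _ => ?_
  have hpos : 0 ≤ ∑ j, eigen (n j) m := Finset.sum_nonneg fun j _ => eigen_nonneg _ _
  rw [inner_tensorLp_mcfProj_sub]
  split_ifs with hn
  · rw [norm_zero, zero_pow two_ne_zero, mul_zero]
    positivity
  · rw [norm_neg, ← mul_assoc]
    refine mul_le_mul_of_nonneg_right ?_ (sq_nonneg _)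
    set Λ := (m : ℝ) ^ (2 * m) * ∑ j, eigen (n j) m
    have hΛ : 0 ≤ Λ := by positivity
    have h1 : (N : ℝ) ^ (2 * m) ≤ Λ := pow_le_sum_eigen hm hmN hn
    have h2 : ∑ i, (n i : ℝ) ^ 2 * (N : ℝ) ^ (2 * m) ≤ d * ((N : ℝ) ^ 2 * Λ) := by
      refine (Finset.sum_le_sum fun i _ => sq_mul_pow_le_sum_eigen hm hmN hn i).trans_eq ?_
      simp [Λ]
    have h3 : Λ ≤ (N : ℝ) ^ 2 * Λ := le_mul_of_one_le_left hΛ (one_le_pow₀ hN1)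
    have h4 : 4 * d * (N : ℝ) ^ 2 * ((m : ℝ) ^ (2 * m) / (N : ℝ) ^ (2 * m)) *
        ∑ j, eigen (n j) m = 4 * d * ((N : ℝ) ^ 2 * Λ) / (N : ℝ) ^ (2 * m) := by
      simp only [Λ]; ring
    rw [h4, le_div_iff₀ (by positivity)]
    rw [← Finset.sum_mul] at h2
    have h5 : (d : ℝ) * (N : ℝ) ^ (2 * m) ≤ d * ((N : ℝ) ^ 2 * Λ) :=
      mul_le_mul_of_nonneg_left (h1.trans h3) (by positivity)
    nlinarith

end MappedChebyshev

end

theorem mainTheorem3 (d : ℕ) (hd : 1 ≤ d) (m : ℕ) (hm : 1 ≤ m) :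
    ∃ c : ℝ, 0 < c ∧
      ∀ u : Lp ℂ 2 (volume : Measure (EuclideanSpace ℝ (Fin d))),
        MappedChebyshev.MemB m u →
      ∀ N : ℕ, 1 ≤ N → m ≤ N + 1 →
      ∀ s : ℝ, 0 ≤ s → s ≤ 1 →
        MappedChebyshev.sobolevNorm s (MappedChebyshev.mcfProj d N u - u) ≤
          ENNReal.ofReal (c * (N : ℝ) ^ (s - m) * MappedChebyshev.seminormB m u) := by
  have hm0 : (0 : ℝ) < m := by exact_mod_cast hm
  -- in the square of the constant, `2` comes from the `L²` error and `4 d` from the gradient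
  refine ⟨(m : ℝ) ^ m * √(2 + 4 * d), by positivity, fun u hu N hN hmN s hs hs1 => ?_⟩
  have hN0 : (0 : ℝ) < N := by exact_mod_cast hN
  have hN1 : (1 : ℝ) ≤ N := by exact_mod_cast hN
  refine (MappedChebyshev.sobolevNorm_le hs hs1 hN1 _ (by positivity)
    (MappedChebyshev.norm_sq_mcfProj_sub_le hm hN hmN u hu)
    (MappedChebyshev.gradEnergy_mcfProj_sub_le hm hN hmN u hu)).trans
    (ENNReal.ofReal_le_ofReal ?_)
  have hA := MappedChebyshev.seminormB_nonneg m u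
  refine Real.sqrt_le_iff.2 ⟨by positivity, le_of_eq ?_⟩
  have h1 : ((N : ℝ) ^ (s - m)) ^ 2 = (N : ℝ) ^ (2 * s) / (N : ℝ) ^ (2 * m) := by
    rw [← Real.rpow_natCast, ← Real.rpow_mul hN0.le, ← Real.rpow_natCast _ (2 * m),
      ← Real.rpow_sub hN0]
    congr 1
    push_cast
    ring
  rw [mul_pow, mul_pow, mul_pow, h1, Real.sq_sqrt (by positivity)]
  field_simp
  ring
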